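/- Let $K$ be a field of characteristic $0$. A meander $\frac{\lambda}{\mu}$ on $n\ge 0$ nodes is given by a pair $(\lambda,\mu)$ of compositions of $n$ (with positive parts; the empty composition is the only composition of $0$). Its seaweed algebra $\mathfrak p_n\frac{\lambda}{\mu}\subseteq\mathfrak{gl}_n(K)$ is the Lie algebra of all $n\times n$ matrices whose nonzero entries above the diagonal lie in the diagonal blocks with sizes $\lambda_1,\lambda_2,\dots$ and whose nonzero entries below the diagonal lie in the diagonal blocks with sizes $\mu_1,\mu_2,\dots$. The index of $\frac{\lambda}{\mu}$ is the index of this Lie algebra, where $$\operatorname{ind}(\mathfrak g)=\min_{f\in\mathfrak g^*}\dim\{x\in\mathfrak g : f([x,y])=0\text{ for all }y\in\mathfrak g\}.$$ For a set $J$ of positive integers let $a^{J}_{n,k}$ be the number of meanders $\frac{\lambda}{\mu}$ on $n$ nodes of index $k$ such that all parts of $\lambda$ and $\mu$ lie in $J$. Put $$A_{\{1,2\}}(x,y)=\sum_{n,k\ge 0}a^{\{1,2\}}_{n,k}x^ny^k,\qquad A_{\{1,2,n\}}(x,y)=\sum_{n,k\ge 0}a^{\{1,2,n\}}_{n,k}x^ny^k,$$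 where in the second series the set of allowed parts $\{1,2,n\}$ depends on the number $n$ of nodes. Theorem. As formal power series, $$A_{\{1,2,n\}}(x,y)=A_{\{1,2\}}(x,y)+\frac{3x^3y^3+2x^3y^2-2x^2y-2}{1-xy}+\frac{2\,(1+xy-x^2+x^3y+x^2y^2-x^4y^2)}{1-x^2-x^2y-x^4y-x^4y^2+x^6y^2},$$ where $$A_{\{1,2\}}(x,y)=\frac{1-x}{(1-xy-x^2y^2)(1-x)-2x^2y}.$$ -/

import Mathlib

attribute [local instance] LieRing.ofAssociativeRing

/-- A meander on `n` nodes, recorded by its top and bottom compositions of `n`. -/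
abbrev Meander (n : ℕ) : Type := Composition n × Composition n

theorem composition_index_mono {n : ℕ} (c : Composition n) {i j : Fin n} (h : i ≤ j) :
    c.index i ≤ c.index j := by
  by_contra hlt
  have h1 : (c.index j).succ.val ≤ (c.index i).val := by
    have := not_le.mp hlt
    simpa [Nat.succ_le_iff] using this
  have h2 := c.lt_sizeUpTo_index_succ j
  have h3 := c.sizeUpTo_index_le i
  have h4 := c.monotone_sizeUpTo h1
  have h5 : (i : ℕ) ≤ j := h
  omega

/-- The positions in which matrices of the seaweed algebra of `m` may be nonzero: on and above the
diagonal these are the diagonal blocks given by the top composition, on and below the diagonal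
those given by the bottom composition. -/
def seaweedPosition {n : ℕ} (m : Meander n) (i j : Fin n) : Prop :=
  (i ≤ j → m.1.index i = m.1.index j) ∧ (j ≤ i → m.2.index i = m.2.index j)

theorem seaweedPosition_trans {n : ℕ} (m : Meander n) {i j k : Fin n}
    (hij : seaweedPosition m i j) (hjk : seaweedPosition m j k) : seaweedPosition m i k := by
  have key : ∀ (c : Composition n) {a b d : Fin n}, a ≤ b → b ≤ d → c.index a = c.index d →
      c.index a = c.index b ∧ c.index b = c.index d := by
    intro c a b d hab hbd h
    have h1 := composition_index_mono c hab
    have h2 := composition_index_mono c hbd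
    exact ⟨le_antisymm h1 (h ▸ h2), le_antisymm h2 (h ▸ h1)⟩
  constructor
  · intro hik
    rcases le_total i j with h1 | h1
    · rcases le_total j k with h2 | h2
      · exact (hij.1 h1).trans (hjk.1 h2)
      · exact (key m.1 hik h2 (hij.1 h1)).1
    · exact (key m.1 h1 hik (hjk.1 (h1.trans hik))).2
  · intro hki
    rcases le_total j i with h1 | h1
    · rcases le_total k j with h2 | h2
      · exact (hij.2 h1).trans (hjk.2 h2)
      · exact (key m.2 h2 hki (hij.2 h1).symm).2.symm
    · exact (key m.2 hki h1 (hjk.2 (hki.trans h1)).symm).1.symm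

/-- The seaweed algebra of a meander `m` on `n` nodes, as a Lie subalgebra of `𝔤𝔩ₙ(K)` (the
`n × n` matrices with the commutator bracket). -/
def seaweedAlgebra (K : Type*) [Field K] {n : ℕ} (m : Meander n) :
    LieSubalgebra K (Matrix (Fin n) (Fin n) K) where
  carrier := {M | ∀ i j, M i j ≠ 0 → seaweedPosition m i j}
  add_mem' := by
    intro M N hM hN i j h
    by_cases h1 : M i j = 0
    · exact hN i j (fun h2 => h (by simp [h1, h2]))
    · exact hM i j h1
  zero_mem' := by
    intro i j h
    exact absurd rfl h
  smul_mem' := by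
    intro c M hM i j h
    exact hM i j (fun h1 => h (by simp [h1]))
  lie_mem' := by
    have mul_mem : ∀ {M N : Matrix (Fin n) (Fin n) K},
        (∀ i j, M i j ≠ 0 → seaweedPosition m i j) → (∀ i j, N i j ≠ 0 → seaweedPosition m i j) →
        ∀ i j, (M * N) i j ≠ 0 → seaweedPosition m i j := by
      intro M N hM hN i j h
      rw [Matrix.mul_apply] at h
      obtain ⟨k, -, hk⟩ := Finset.exists_ne_zero_of_sum_ne_zero h
      exact seaweedPosition_trans m (hM i k (left_ne_zero_of_mul hk))
        (hN k j (right_ne_zero_of_mul hk))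
    intro M N hM hN i j h
    rw [Ring.lie_def, Matrix.sub_apply] at h
    by_cases h1 : (M * N) i j = 0
    · exact mul_mem hN hM i j (fun h2 => h (by simp [h1, h2]))
    · exact mul_mem hM hN i j h1

/-- The stabilizer `{x | f ⁅x, y⁆ = 0 for all y}` of a functional `f` under the coadjoint action. -/
def coadjointStabilizer {K L : Type*} [Field K] [LieRing L] [LieAlgebra K L]
    (f : Module.Dual K L) : Submodule K L where
  carrier := {x | ∀ y, f ⁅x, y⁆ = 0}
  add_mem' := by
    intro a b ha hb y
    rw [add_lie, map_add, ha y, hb y, add_zero]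
  zero_mem' := by
    intro y
    rw [zero_lie, map_zero]
  smul_mem' := by
    intro c a ha y
    rw [smul_lie, map_smul, ha y, smul_zero]

/-- The index of a (finite-dimensional) Lie algebra: the minimal dimension of the stabilizer of a
functional. -/
noncomputable def lieIndex (K L : Type*) [Field K] [LieRing L] [LieAlgebra K L] : ℕ :=
  ⨅ f : Module.Dual K L, Module.finrank K (coadjointStabilizer f)

/-- The index of a meander: the index of its seaweed algebra. -/
noncomputable def meanderIndex (K : Type*) [Field K] {n : ℕ} (m : Meander n) : ℕ :=
  lieIndex K (seaweedAlgebra K m)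

/-- The number of meanders on `n` nodes of index `k` all of whose parts lie in `J`. -/
noncomputable def meanderCount (K : Type*) [Field K] (J : Set ℕ) (n k : ℕ) : ℕ :=
  Nat.card {m : Meander n //
    (∀ p ∈ m.1.blocks, p ∈ J) ∧ (∀ p ∈ m.2.blocks, p ∈ J) ∧ meanderIndex K m = k}

/-- `A_J(x, y) = ∑ a_{n,k}^J x ^ n y ^ k`, where the set `J n` of allowed parts may depend on the
number `n` of nodes; the variable with index `0` is `x`, the one with index `1` is `y`. -/
noncomputable def meanderGenFun (K : Type*) [Field K] (J : ℕ → Set ℕ) :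
    MvPowerSeries (Fin 2) ℚ :=
  fun d => (meanderCount K (J (d 0)) (d 0) (d 1) : ℚ)

/-! Through the trace form every functional on a seaweed algebra is `x ↦ tr (F x)`. The index is
therefore the least dimension of the space of matrices `x`, supported on the allowed positions, for
which `F x - x F` vanishes in the transposed positions. This dimension is upper semicontinuous in
`F`, so a lower bound need only be checked for generic `F`; characteristic zero makes the field
infinite.

For generic `F` suitable entries or blocks of `F` are invertible, and the stabilizer equations can
be solved for the outer blocks of `x`. This strips nodes off the ends of the meander. Equal first
parts `p` split off `𝔤𝔩ₚ`, of index `p` (`pairIndex_cons_cons_self`). First parts `1` over `2` lose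
one node without changing the index (`pairIndex_one_cons_two_cons`). If one side is the single part
`n`, the algebra is parabolic, with block sizes given by the other side. Equal first and last blocks
`p` can then be removed, contributing `p` (`flagIndex_cons_append_self`), while outer blocks `1` and
`2` reduce to a last block `1` at no cost (`flagIndex_one_cons_append_two`). Outer blocks `2` and
`1` follow by reversal.

Summing `y ^ index` over words in `1` and `2` turns these reductions into linear recurrences:
`pairPoly` is coupled with `leadPoly`, and `flagPoly` with `lastPoly`. Solving them gives the two
rational functions with denominators of degree above one. For `n ≥ 3` the additional meanders have
`n` on exactly one side, counted by `2 * flagPoly n`, or on both sides, counted by `y ^ n`. For `n <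
3` nothing is added, so the low-order terms of these two series are subtracted. -/

/-! ### Index of an algebra of matrices with prescribed support: symmetries and semicontinuity. -/

/-- The stabilizer of the functional `x ↦ tr (F x)` in the algebra of matrices supported on `S`. -/
def matrixStabilizer {K ι : Type*} [Field K] [Fintype ι] (S : ι → ι → Prop)
    (F : Matrix ι ι K) : Submodule K (Matrix ι ι K) where
  carrier := {x | (∀ i j, ¬ S i j → x i j = 0) ∧ ∀ i j, S i j → (F * x - x * F) j i = 0}
  add_mem' := by
    rintro a b ⟨ha, ha'⟩ ⟨hb, hb'⟩
    refine ⟨fun i j h => by simp [ha i j h, hb i j h], fun i j h => ?_⟩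
    have : F * (a + b) - (a + b) * F = (F * a - a * F) + (F * b - b * F) := by noncomm_ring
    rw [this, Matrix.add_apply, ha' i j h, hb' i j h, add_zero]
  zero_mem' := by simp
  smul_mem' := by
    rintro c a ⟨ha, ha'⟩
    refine ⟨fun i j h => by simp [ha i j h], fun i j h => ?_⟩
    have : F * (c • a) - (c • a) * F = c • (F * a - a * F) := by
      rw [Matrix.mul_smul, Matrix.smul_mul, smul_sub]
    rw [this, Matrix.smul_apply, ha' i j h, smul_zero]

theorem mem_matrixStabilizer {K ι : Type*} [Field K] [Fintype ι] {S : ι → ι → Prop}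
    {F x : Matrix ι ι K} : x ∈ matrixStabilizer S F ↔
      (∀ i j, ¬ S i j → x i j = 0) ∧ ∀ i j, S i j → (F * x - x * F) j i = 0 := Iff.rfl

/-- The index of the algebra of matrices supported on `S`. -/
noncomputable def relIndex (K : Type*) {ι : Type*} [Field K] [Fintype ι] (S : ι → ι → Prop) : ℕ :=
  ⨅ F : Matrix ι ι K, Module.finrank K (matrixStabilizer S F)

section
variable {K : Type*} [Field K] {ι κ : Type*} [Fintype ι] [Fintype κ]

theorem relIndex_le (S : ι → ι → Prop) (F : Matrix ι ι K) :
    relIndex K S ≤ Module.finrank K (matrixStabilizer S F) :=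
  ciInf_le (OrderBot.bddBelow _) F

theorem exists_relIndex_eq (K : Type*) [Field K] (S : ι → ι → Prop) :
    ∃ F : Matrix ι ι K, Module.finrank K (matrixStabilizer S F) = relIndex K S :=
  ciInf_mem (fun F : Matrix ι ι K => Module.finrank K (matrixStabilizer S F))

theorem relIndex_eq {S : ι → ι → Prop} {d : ℕ} (F : Matrix ι ι K)
    (hF : Module.finrank K (matrixStabilizer S F) = d)
    (h : ∀ F : Matrix ι ι K, d ≤ Module.finrank K (matrixStabilizer S F)) : relIndex K S = d :=
  le_antisymm (hF ▸ relIndex_le S F) (le_ciInf h)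

theorem relIndex_congr {S : ι → ι → Prop} {T : κ → κ → Prop} (e : ι ≃ κ)
    (h : ∀ i j, S i j ↔ T (e i) (e j)) : relIndex K S = relIndex K T := by
  refine (Matrix.reindex e e).iInf_congr fun F => ?_
  refine Eq.trans ?_ (LinearEquiv.finrank_eq
    ((Matrix.reindexLinearEquiv K K e e).submoduleMap (matrixStabilizer S F))).symm
  refine congrArg (fun N : Submodule K (Matrix κ κ K) => Module.finrank K N) ?_
  ext x
  symm
  rw [Submodule.mem_map_equiv, mem_matrixStabilizer, mem_matrixStabilizer]
  have key : ∀ i j, (F * ((Matrix.reindexLinearEquiv K K e e).symm x)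
      - ((Matrix.reindexLinearEquiv K K e e).symm x) * F) i j
      = (Matrix.reindex e e F * x - x * Matrix.reindex e e F) (e i) (e j) := by
    intro i j
    simp only [Matrix.sub_apply, Matrix.mul_apply]
    rw [← e.sum_comp, ← e.sum_comp (fun k => x (e i) k * _)]
    simp
  constructor
  · rintro ⟨h1, h2⟩
    refine ⟨fun i j hij => ?_, fun i j hij => ?_⟩
    · simpa using h1 (e.symm i) (e.symm j) (by simpa [h] using hij)
    · have h' := h2 (e.symm i) (e.symm j) (by simpa [h] using hij)
      rwa [key, e.apply_symm_apply, e.apply_symm_apply] at h'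
  · rintro ⟨h1, h2⟩
    refine ⟨fun i j hij => ?_, fun i j hij => ?_⟩
    · simpa using h1 (e i) (e j) (by simpa [h] using hij)
    · rw [key]; exact h2 _ _ ((h i j).1 hij)

/-- Transposition turns the commutator with `F` into minus the commutator with the transpose of `F`.
-/
theorem relIndex_swap (S : ι → ι → Prop) :
    relIndex K (fun i j => S j i) = relIndex K S := by
  refine (Matrix.transposeAddEquiv ι ι K).toEquiv.iInf_congr fun F => ?_
  refine Eq.trans ?_ (LinearEquiv.finrank_eq
    ((Matrix.transposeLinearEquiv ι ι K K).submoduleMap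
      (matrixStabilizer (fun i j => S j i) F))).symm
  refine congrArg (fun N : Submodule K (Matrix ι ι K) => Module.finrank K N) ?_
  ext x
  symm
  rw [Submodule.mem_map_equiv, mem_matrixStabilizer, mem_matrixStabilizer]
  have key : ∀ i j, (F * ((Matrix.transposeLinearEquiv ι ι K K).symm x)
      - ((Matrix.transposeLinearEquiv ι ι K K).symm x) * F) i j
      = - (F.transpose * x - x * F.transpose) j i := by
    intro i j
    simp [Matrix.mul_apply, mul_comm]
  constructor
  · rintro ⟨h1, h2⟩
    exact ⟨fun i j hij => h1 j i hij, fun i j hij => by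
      have := h2 j i hij
      rw [key] at this
      exact neg_eq_zero.1 this⟩
  · rintro ⟨h1, h2⟩
    exact ⟨fun i j hij => h1 j i hij, fun i j hij => by
      rw [key, neg_eq_zero]
      exact h2 j i hij⟩

/-- Lower semicontinuity of the rank along a line. -/
theorem le_finrank_ker_of_infinite {V W : Type*} [AddCommGroup V] [Module K V]
    [FiniteDimensional K V] [AddCommGroup W] [Module K W] (A B : V →ₗ[K] W) (d : ℕ)
    (h : {t : K | d ≤ Module.finrank K (LinearMap.ker (A + t • B))}.Infinite) :
    d ≤ Module.finrank K (LinearMap.ker A) := by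
  obtain ⟨U, hU⟩ := (LinearMap.ker A).exists_isCompl
  have hinj : LinearMap.ker (A.domRestrict U) = ⊥ := by
    rw [LinearMap.ker_eq_bot']
    intro u hu
    have : (u : V) ∈ LinearMap.ker A ⊓ U := ⟨hu, u.2⟩
    rw [hU.inf_eq_bot] at this
    exact Subtype.ext this
  obtain ⟨L, hL⟩ := (A.domRestrict U).exists_leftInverse_of_injective hinj
  -- A nonzero `u ∈ U` killed by `A + t B` satisfies `u + t M u = 0`, so `-1/t` is an eigenvalue of
  -- `M`. This excludes only finitely many `t`; for the others the kernel meets `U` trivially and is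
  -- no larger than `ker A`.
  set M : Module.End K U := L ∘ₗ B.domRestrict U with hM
  have hfin : {t : K | M.HasEigenvalue (-t⁻¹)}.Finite := by
    refine Set.Finite.preimage (f := fun t : K => -t⁻¹) ?_ (M.finite_hasEigenvalue)
    intro a _ b _ hab
    simpa using hab
  obtain ⟨t, ht, hte⟩ := (h.sdiff hfin).nonempty
  have hdisj : LinearMap.ker (A + t • B) ⊓ U = ⊥ := by
    rw [Submodule.eq_bot_iff]
    rintro u ⟨hu, huU⟩
    by_contra hne
    have h1 : L (A u + t • B u) = 0 := by
      have : A u + t • B u = 0 := hu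
      rw [this, map_zero]
    have h2 : L (A u) = ⟨u, huU⟩ := LinearMap.congr_fun hL ⟨u, huU⟩
    have h3 : L (B u) = M ⟨u, huU⟩ := rfl
    rw [map_add, map_smul, h2, h3] at h1
    have ht0 : t ≠ 0 := by
      rintro rfl
      simp at h1
      exact hne h1
    refine hte (Module.End.hasEigenvalue_of_hasEigenvector (x := ⟨u, huU⟩) ⟨?_, ?_⟩)
    · rw [Module.End.mem_eigenspace_iff]
      have : M ⟨u, huU⟩ = t⁻¹ • (t • M ⟨u, huU⟩) := by rw [smul_smul, inv_mul_cancel₀ ht0, one_smul]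
      rw [this, eq_neg_of_add_eq_zero_right h1, smul_neg, neg_smul]
    · intro h0
      exact hne (congrArg Subtype.val h0)
  have h1 := Submodule.finrank_add_eq_of_isCompl hU
  have h2 := Submodule.finrank_sup_add_finrank_inf_eq (LinearMap.ker (A + t • B)) U
  rw [hdisj, finrank_bot] at h2
  have h3 := Submodule.finrank_le (LinearMap.ker (A + t • B) ⊔ U)
  have ht' : d ≤ Module.finrank K (LinearMap.ker (A + t • B)) := ht
  omega

/-- The bracket with `F`, transposed and restricted to the positions in `S`. -/
noncomputable def bracketOn (S : ι → ι → Prop) (F : Matrix ι ι K) :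
    Matrix ι ι K →ₗ[K] Matrix ι ι K := by
  classical exact
  { toFun := fun x => Matrix.of fun i j => if S i j then (F * x - x * F) j i else 0
    map_add' := fun a b => by
      have : F * (a + b) - (a + b) * F = (F * a - a * F) + (F * b - b * F) := by noncomm_ring
      ext i j
      simp only [this, Matrix.of_apply, Matrix.add_apply]
      split_ifs <;> simp
    map_smul' := fun c a => by
      have : F * (c • a) - (c • a) * F = c • (F * a - a * F) := by
        rw [Matrix.mul_smul, Matrix.smul_mul, smul_sub]
      ext i j
      simp only [this, Matrix.of_apply, Matrix.smul_apply, RingHom.id_apply]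
      split_ifs <;> simp }

/-- The entries of a matrix outside of `S`. -/
noncomputable def offSupport (S : ι → ι → Prop) : Matrix ι ι K →ₗ[K] Matrix ι ι K := by
  classical exact
  { toFun := fun x => Matrix.of fun i j => if S i j then 0 else x i j
    map_add' := fun a b => by
      ext i j
      simp only [Matrix.of_apply, Matrix.add_apply]
      split_ifs <;> simp
    map_smul' := fun c a => by
      ext i j
      simp only [Matrix.of_apply, Matrix.smul_apply, RingHom.id_apply]
      split_ifs <;> simp }

/-- Support conditions and stabilizer equations live at complementary positions, so they fit into
one linear map that depends affinely on `F`. This is the form that the semicontinuity of the kernel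
requires. -/
theorem ker_offSupport_add_bracketOn (S : ι → ι → Prop) (F : Matrix ι ι K) :
    LinearMap.ker (offSupport S + bracketOn S F) = matrixStabilizer S F := by
  classical
  ext x
  rw [LinearMap.mem_ker, mem_matrixStabilizer, ← Matrix.ext_iff]
  have : ∀ i j, (((offSupport S : Matrix ι ι K →ₗ[K] Matrix ι ι K) + bracketOn S F) x) i j =
      if S i j then (F * x - x * F) j i else x i j := by
    intro i j
    change (if S i j then 0 else x i j) + (if S i j then (F * x - x * F) j i else 0) = _
    split_ifs <;> simp
  constructor
  · intro h
    refine ⟨fun i j hij => ?_, fun i j hij => ?_⟩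
    · have h' := h i j
      rwa [this, if_neg hij] at h'
    · have h' := h i j
      rwa [this, if_pos hij] at h'
  · rintro ⟨h1, h2⟩ i j
    rw [this]
    split_ifs with hij
    · exact h2 i j hij
    · exact h1 i j hij

theorem bracketOn_add_smul (S : ι → ι → Prop) (F G : Matrix ι ι K) (t : K) :
    bracketOn S (F + t • G) = bracketOn S F + t • bracketOn S G := by
  classical
  refine LinearMap.ext fun x => ?_
  ext i j
  change (if S i j then ((F + t • G) * x - x * (F + t • G)) j i else 0) =
    (if S i j then (F * x - x * F) j i else 0) + t • (if S i j then (G * x - x * G) j i else 0)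
  split_ifs
  · simp only [Matrix.add_mul, Matrix.mul_add, Matrix.smul_mul, Matrix.mul_smul, Matrix.sub_apply,
      Matrix.add_apply, Matrix.smul_apply, smul_eq_mul]
    ring
  · simp

/-- The genericity principle behind all lower bounds for the index: `F` may be moved along a line in
a direction `G` of choice, avoiding finitely many bad parameters. -/
theorem le_finrank_matrixStabilizer_of_infinite {S : ι → ι → Prop} (F G : Matrix ι ι K) {d : ℕ}
    (h : {t : K | d ≤ Module.finrank K (matrixStabilizer S (F + t • G))}.Infinite) :
    d ≤ Module.finrank K (matrixStabilizer S F) := by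
  rw [← ker_offSupport_add_bracketOn]
  refine le_finrank_ker_of_infinite _ (bracketOn S G) d ?_
  have hker : ∀ t : K, LinearMap.ker (offSupport S + bracketOn S F + t • bracketOn S G) =
      matrixStabilizer S (F + t • G) := fun t => by
    rw [← ker_offSupport_add_bracketOn, bracketOn_add_smul, add_assoc]
  refine Set.Infinite.mono (fun t (ht : d ≤ _) => ?_) h
  rw [← hker t] at ht
  exact ht

theorem matrixStabilizer_smul (S : ι → ι → Prop) (F : Matrix ι ι K) {a : K} (ha : a ≠ 0) :
    matrixStabilizer S (a • F) = matrixStabilizer S F := by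
  ext x
  rw [mem_matrixStabilizer, mem_matrixStabilizer]
  have : a • F * x - x * (a • F) = a • (F * x - x * F) := by
    rw [Matrix.mul_smul, Matrix.smul_mul, smul_sub]
  simp only [this, Matrix.smul_apply, smul_eq_mul, mul_eq_zero, ha, false_or]

end

/-! ### The index of `𝔤𝔩ₙ` and of direct sums. -/

section
variable {K : Type*} [Field K] {ι κ : Type*} [Fintype ι] [Fintype κ]

/-- The determinant says that `v` is a cyclic vector of `A`; a linear relation between the powers of
`A` would give one between the vectors `A ^ k v`. -/
theorem linearIndependent_pow_of_det_ne_zero {n : ℕ} (A : Matrix (Fin n) (Fin n) K)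
    (v : Fin n → K) (h : (Matrix.of fun i k : Fin n => ((A ^ (k : ℕ)).mulVec v) i).det ≠ 0) :
    LinearIndependent K fun k : Fin n => A ^ (k : ℕ) := by
  rw [Fintype.linearIndependent_iff]
  intro g hg
  have h0 : (Matrix.of fun i k : Fin n => ((A ^ (k : ℕ)).mulVec v) i).mulVec g = 0 := by
    ext i
    have := congrFun (congrArg (fun M : Matrix (Fin n) (Fin n) K => M.mulVec v) hg) i
    simp only [Matrix.sum_mulVec, Matrix.smul_mulVec, Finset.sum_apply, Pi.smul_apply,
      Matrix.zero_mulVec, smul_eq_mul] at this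
    simpa [Matrix.mulVec, dotProduct, mul_comm] using this
  exact congrFun (Matrix.eq_zero_of_mulVec_eq_zero h h0)

theorem le_finrank_centralizer_of_det_ne_zero {n : ℕ} (A : Matrix (Fin n) (Fin n) K)
    (v : Fin n → K) (h : (Matrix.of fun i k : Fin n => ((A ^ (k : ℕ)).mulVec v) i).det ≠ 0) :
    n ≤ Module.finrank K (matrixStabilizer (fun _ _ => True) A) := by
  have hmem : ∀ k : Fin n, A ^ (k : ℕ) ∈ matrixStabilizer (fun _ _ => True) A := fun k => by
    rw [mem_matrixStabilizer, ← pow_succ, ← pow_succ']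
    simp
  have hli : LinearIndependent K
      fun k : Fin n => (⟨A ^ (k : ℕ), hmem k⟩ : matrixStabilizer (fun _ _ => True) A) :=
    LinearIndependent.of_comp (matrixStabilizer (fun _ _ => True) A).subtype
      (linearIndependent_pow_of_det_ne_zero A v h)
  simpa using hli.fintype_card_le_finrank

/-- The stabilizer is the centralizer of `F`. It has dimension at least `n` when `F` has a cyclic
vector, which is generic, and exactly `n` for a diagonal matrix with distinct entries. -/
theorem relIndex_true [CharZero K] (n : ℕ) :
    relIndex K (fun _ _ : Fin n => True) = n := by
  set D : Matrix (Fin n) (Fin n) K := Matrix.diagonal fun i => ((i : ℕ) : K) with hD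
  have hdist : ∀ i j : Fin n, ((i : ℕ) : K) = ((j : ℕ) : K) → i = j := fun i j h =>
    Fin.ext (Nat.cast_injective h)
  have hdetD : (Matrix.of fun i k : Fin n => ((D ^ (k : ℕ)).mulVec 1) i).det ≠ 0 := by
    have : (Matrix.of fun i k : Fin n => ((D ^ (k : ℕ)).mulVec 1) i) =
        Matrix.vandermonde fun i : Fin n => ((i : ℕ) : K) := by
      ext i k
      simp [hD, Matrix.diagonal_pow, Matrix.mulVec_diagonal, Matrix.vandermonde_apply]
    rw [this, Matrix.det_vandermonde_ne_zero_iff]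
    exact fun i j h => hdist i j h
  have hlow : ∀ F : Matrix (Fin n) (Fin n) K,
      n ≤ Module.finrank K (matrixStabilizer (fun _ _ => True) F) := by
    intro F
    -- The line runs from `F` at `t = 0` to `D` at `t = 1`. The cyclicity determinant of the
    -- all-ones vector along it is a polynomial `P` in `t`, nonzero because its value at `1` is a
    -- Vandermonde determinant.
    refine le_finrank_matrixStabilizer_of_infinite F (D - F) ?_
    let Q : Matrix (Fin n) (Fin n) (Polynomial K) := F.map Polynomial.C +
      (Polynomial.X : Polynomial K) • (D - F).map Polynomial.C
    let P : Polynomial K := (Matrix.of fun i k : Fin n => ((Q ^ (k : ℕ)).mulVec 1) i).det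
    have hP : ∀ t : K, P.eval t =
        (Matrix.of fun i k : Fin n => (((F + t • (D - F)) ^ (k : ℕ)).mulVec 1) i).det := by
      intro t
      have hmap : Q.map (Polynomial.evalRingHom t) = F + t • (D - F) := by
        ext i j
        simp [Q]
      rw [← Polynomial.coe_evalRingHom, RingHom.map_det]
      congr 1
      ext i k
      have hpow : (F + t • (D - F)) ^ (k : ℕ) = (Q ^ (k : ℕ)).map (Polynomial.evalRingHom t) := by
        rw [← hmap]
        exact (map_pow (Polynomial.evalRingHom t).mapMatrix Q k).symm
      rw [Matrix.of_apply, hpow]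
      simp [Matrix.mulVec, dotProduct, Polynomial.eval_finsetSum]
    have hP0 : P ≠ 0 := by
      intro h0
      have := hP 1
      rw [h0, one_smul, add_sub_cancel] at this
      exact hdetD (by simpa using this.symm)
    classical
    have hfin := P.roots.toFinset.finite_toSet
    refine hfin.infinite_compl.mono fun t ht => ?_
    refine le_finrank_centralizer_of_det_ne_zero _ 1 ?_
    rw [← hP]
    intro h0
    exact ht (by simp [hP0, Polynomial.IsRoot, h0])
  refine relIndex_eq D (le_antisymm ?_ (hlow D)) hlow
  have hsub : ∀ x ∈ matrixStabilizer (fun _ _ => True) D,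
      x ∈ LinearMap.range (Matrix.diagonalLinearMap (Fin n) K K) := by
    intro x hx
    refine ⟨fun i => x i i, ?_⟩
    change Matrix.diagonal (fun i => x i i) = x
    ext i j
    rw [Matrix.diagonal_apply]
    split_ifs with hij
    · rw [hij]
    · have := (mem_matrixStabilizer.1 hx).2 j i trivial
      rw [Matrix.sub_apply, hD, Matrix.diagonal_mul, Matrix.mul_diagonal, mul_comm, ← mul_sub] at this
      rcases mul_eq_zero.1 this with h | h
      · exact h.symm
      · exact absurd (hdist _ _ (sub_eq_zero.1 h)) hij
  calc _ ≤ Module.finrank K (LinearMap.range (Matrix.diagonalLinearMap (Fin n) K K)) :=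
        Submodule.finrank_mono hsub
    _ ≤ Module.finrank K (Fin n → K) := LinearMap.finrank_range_le _
    _ = n := by simp

/-- The disjoint union of two relations. -/
def sumRel (S : ι → ι → Prop) (T : κ → κ → Prop) : ι ⊕ κ → ι ⊕ κ → Prop
  | .inl i, .inl j => S i j
  | .inr i, .inr j => T i j
  | _, _ => False

theorem mem_matrixStabilizer_sumRel {S : ι → ι → Prop} {T : κ → κ → Prop}
    {F x : Matrix (ι ⊕ κ) (ι ⊕ κ) K} : x ∈ matrixStabilizer (sumRel S T) F ↔
      x.toBlocks₁₂ = 0 ∧ x.toBlocks₂₁ = 0 ∧ x.toBlocks₁₁ ∈ matrixStabilizer S F.toBlocks₁₁ ∧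
        x.toBlocks₂₂ ∈ matrixStabilizer T F.toBlocks₂₂ := by
  have e11 : ∀ i j, (F * x - x * F) (.inl i) (.inl j) =
      (F.toBlocks₁₁ * x.toBlocks₁₁ - x.toBlocks₁₁ * F.toBlocks₁₁) i j +
      ((F.toBlocks₁₂ * x.toBlocks₂₁) i j - (x.toBlocks₁₂ * F.toBlocks₂₁) i j) := fun i j => by
    simp only [Matrix.sub_apply, Matrix.mul_apply, Fintype.sum_sum_type, Matrix.toBlocks₁₁,
      Matrix.toBlocks₁₂, Matrix.toBlocks₂₁, Matrix.of_apply]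
    ring
  have e22 : ∀ i j, (F * x - x * F) (.inr i) (.inr j) =
      (F.toBlocks₂₂ * x.toBlocks₂₂ - x.toBlocks₂₂ * F.toBlocks₂₂) i j +
      ((F.toBlocks₂₁ * x.toBlocks₁₂) i j - (x.toBlocks₂₁ * F.toBlocks₁₂) i j) := fun i j => by
    simp only [Matrix.sub_apply, Matrix.mul_apply, Fintype.sum_sum_type, Matrix.toBlocks₂₂,
      Matrix.toBlocks₁₂, Matrix.toBlocks₂₁, Matrix.of_apply]
    ring
  simp only [mem_matrixStabilizer]
  constructor
  · rintro ⟨h1, h2⟩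
    have h12 : x.toBlocks₁₂ = 0 := by ext i j; exact h1 _ _ id
    have h21 : x.toBlocks₂₁ = 0 := by ext i j; exact h1 _ _ id
    refine ⟨h12, h21, ⟨fun i j h => h1 _ _ h, fun i j h => ?_⟩,
      ⟨fun i j h => h1 _ _ h, fun i j h => ?_⟩⟩
    · have := h2 (.inl i) (.inl j) h
      rw [e11, h12, h21] at this
      simpa using this
    · have := h2 (.inr i) (.inr j) h
      rw [e22, h12, h21] at this
      simpa using this
  · rintro ⟨h12, h21, ⟨h1, h1'⟩, ⟨h2, h2'⟩⟩
    constructor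
    · rintro (i | i) (j | j) h
      · exact h1 i j h
      · exact congrFun (congrFun h12 i) j
      · exact congrFun (congrFun h21 i) j
      · exact h2 i j h
    · rintro (i | i) (j | j) h
      · rw [e11, h12, h21, h1' i j h]; simp
      · exact h.elim
      · exact h.elim
      · rw [e22, h12, h21, h2' i j h]; simp

theorem finrank_matrixStabilizer_sumRel {S : ι → ι → Prop} {T : κ → κ → Prop}
    (F : Matrix (ι ⊕ κ) (ι ⊕ κ) K) :
    Module.finrank K (matrixStabilizer (sumRel S T) F) =
      Module.finrank K (matrixStabilizer S F.toBlocks₁₁) +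
        Module.finrank K (matrixStabilizer T F.toBlocks₂₂) := by
  rw [← Module.finrank_prod]
  refine LinearEquiv.finrank_eq
    { toFun := fun x => (⟨_, (mem_matrixStabilizer_sumRel.1 x.2).2.2.1⟩,
        ⟨_, (mem_matrixStabilizer_sumRel.1 x.2).2.2.2⟩)
      map_add' := fun _ _ => rfl
      map_smul' := fun _ _ => rfl
      invFun := fun p => ⟨Matrix.fromBlocks p.1 0 0 p.2, mem_matrixStabilizer_sumRel.2 (by simp)⟩
      left_inv := fun x => Subtype.ext ?_
      right_inv := fun p => ?_ }
  · have h := mem_matrixStabilizer_sumRel.1 x.2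
    conv_rhs => rw [← Matrix.fromBlocks_toBlocks x.1, h.1, h.2.1]
  · simp

theorem relIndex_sumRel (S : ι → ι → Prop) (T : κ → κ → Prop) :
    relIndex K (sumRel S T) = relIndex K S + relIndex K T := by
  obtain ⟨F, hF⟩ := exists_relIndex_eq K S
  obtain ⟨G, hG⟩ := exists_relIndex_eq K T
  refine relIndex_eq (Matrix.fromBlocks F 0 0 G) ?_ fun H => ?_
  · rw [finrank_matrixStabilizer_sumRel, Matrix.toBlocks_fromBlocks₁₁,
      Matrix.toBlocks_fromBlocks₂₂, hF, hG]
  · rw [finrank_matrixStabilizer_sumRel]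
    exact add_le_add (relIndex_le _ _) (relIndex_le _ _)

end

/-! ### The trace form, and removal of a leaf. -/

section
variable {K : Type*} [Field K]

/-- The functional `x ↦ tr (F x)` on the seaweed algebra. -/
noncomputable def traceFunctional {n : ℕ} (m : Meander n) (F : Matrix (Fin n) (Fin n) K) :
    Module.Dual K (seaweedAlgebra K m) :=
  (Matrix.traceLinearMap (Fin n) K K ∘ₗ LinearMap.mulLeft K F) ∘ₗ
    (seaweedAlgebra K m).toSubmodule.subtype

theorem traceFunctional_apply {n : ℕ} (m : Meander n) (F : Matrix (Fin n) (Fin n) K)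
    (x : seaweedAlgebra K m) : traceFunctional m F x = (F * x.1).trace := rfl

theorem traceFunctional_surjective {n : ℕ} (m : Meander n) :
    Function.Surjective (traceFunctional (K := K) m) := by
  intro f
  obtain ⟨g, hg⟩ := LinearMap.exists_extend (p := (seaweedAlgebra K m).toSubmodule) f
  -- In the trace pairing the entry `(j, i)` of `F` multiplies the entry `(i, j)` of `x`, so it has
  -- to be the value on the matrix unit at `(i, j)`.
  refine ⟨Matrix.of fun j i => g (Matrix.single i j 1), LinearMap.ext fun x => ?_⟩
  have hx : f x = g x.1 := (LinearMap.congr_fun hg x).symm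
  rw [traceFunctional_apply, hx]
  conv_rhs => rw [Matrix.matrix_eq_sum_single x.1]
  simp only [map_sum, Matrix.trace, Matrix.diag_apply, Matrix.mul_apply, Matrix.of_apply]
  rw [Finset.sum_comm]
  refine Finset.sum_congr rfl fun i _ => Finset.sum_congr rfl fun j _ => ?_
  have : Matrix.single i j (x.1 i j) = x.1 i j • Matrix.single i j (1 : K) := by
    rw [Matrix.smul_single, smul_eq_mul, mul_one]
  rw [this, map_smul, smul_eq_mul, mul_comm]

theorem single_mem_seaweedAlgebra {n : ℕ} {m : Meander n} {i j : Fin n}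
    (h : seaweedPosition m i j) : Matrix.single i j (1 : K) ∈ seaweedAlgebra K m := by
  intro a b hab
  rw [Matrix.single_apply] at hab
  split_ifs at hab with h'
  · rw [← h'.1, ← h'.2]; exact h
  · exact absurd rfl hab

theorem traceFunctional_lie {n : ℕ} (m : Meander n) (F : Matrix (Fin n) (Fin n) K)
    (x y : seaweedAlgebra K m) :
    traceFunctional m F ⁅x, y⁆ = ((F * x.1 - x.1 * F) * y.1).trace := by
  rw [traceFunctional_apply, LieSubalgebra.coe_bracket, Ring.lie_def, mul_sub, sub_mul,
    Matrix.trace_sub, Matrix.trace_sub, ← mul_assoc, ← mul_assoc, mul_assoc x.1,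
    Matrix.trace_mul_comm x.1, mul_assoc]

theorem mem_coadjointStabilizer_traceFunctional {n : ℕ} {m : Meander n}
    {F : Matrix (Fin n) (Fin n) K} {x : seaweedAlgebra K m} :
    x ∈ coadjointStabilizer (traceFunctional m F) ↔
      x.1 ∈ matrixStabilizer (seaweedPosition m) F := by
  constructor
  · intro h
    refine ⟨fun i j hij => not_not.1 fun h' => hij (x.2 i j h'), fun i j hij => ?_⟩
    have := h ⟨_, single_mem_seaweedAlgebra hij⟩
    rw [traceFunctional_lie] at this
    simpa [Matrix.trace_mul_single] using this
  · intro h y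
    rw [traceFunctional_lie]
    refine Finset.sum_eq_zero fun j _ => ?_
    rw [Matrix.diag_apply, Matrix.mul_apply]
    refine Finset.sum_eq_zero fun i _ => ?_
    by_cases hij : seaweedPosition m i j
    · rw [h.2 i j hij, zero_mul]
    · rw [not_not.1 fun h' => hij (y.2 i j h'), mul_zero]

theorem meanderIndex_eq_relIndex {n : ℕ} (m : Meander n) :
    meanderIndex K m = relIndex K (seaweedPosition m) := by
  refine ((traceFunctional_surjective m).iInf_congr _ fun F => ?_).symm
  exact LinearEquiv.finrank_eq
    { toFun := fun x => ⟨x.1.1, mem_coadjointStabilizer_traceFunctional.1 x.2⟩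
      map_add' := fun _ _ => rfl
      map_smul' := fun _ _ => rfl
      invFun := fun x => ⟨⟨x.1, fun i j h => not_not.1 fun h' => h (x.2.1 i j h')⟩,
        mem_coadjointStabilizer_traceFunctional.2 x.2⟩
      left_inv := fun _ => rfl
      right_inv := fun _ => rfl }

variable {M : Type*} [Fintype M]

/-- The relation obtained from `S` by adding a point below `y` only. -/
def leafRel (S : M → M → Prop) (y : M) : Unit ⊕ M → Unit ⊕ M → Prop
  | .inl _, .inl _ => True
  | .inl _, .inr _ => False
  | .inr i, .inl _ => i = y
  | .inr i, .inr j => S i j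

/-- The new point meets the old ones only at the position `(y, new)`. With `F (new, y) ≠ 0`, the
equation at the new diagonal position kills the entry of `x` there, and the equation at `(y, new)`
equates the two diagonal entries. Hence the old block determines `x`. -/
theorem mem_matrixStabilizer_leafRel {S : M → M → Prop} {y : M} (hy : S y y)
    (hSy : ∀ i, S i y → i = y) {F x : Matrix (Unit ⊕ M) (Unit ⊕ M) K}
    (hF : F (.inl ()) (.inr y) ≠ 0) : x ∈ matrixStabilizer (leafRel S y) F ↔
      x (.inl ()) (.inl ()) = x (.inr y) (.inr y) ∧ x.toBlocks₁₂ = 0 ∧ x.toBlocks₂₁ = 0 ∧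
        x.toBlocks₂₂ ∈ matrixStabilizer S F.toBlocks₂₂ := by
  rw [mem_matrixStabilizer, mem_matrixStabilizer]
  have e22 : x.toBlocks₁₂ = 0 → x.toBlocks₂₁ = 0 → ∀ i j,
      (F * x - x * F) (.inr i) (.inr j) =
        (F.toBlocks₂₂ * x.toBlocks₂₂ - x.toBlocks₂₂ * F.toBlocks₂₂) i j := fun h12 h21 i j => by
    have h1 : ∀ i, x (.inl ()) (.inr i) = 0 := fun i => congrFun (congrFun h12 ()) i
    have h2 : ∀ i, x (.inr i) (.inl ()) = 0 := fun i => congrFun (congrFun h21 i) ()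
    simp [Matrix.mul_apply, Fintype.sum_sum_type, Matrix.toBlocks₂₂, h1, h2]
  have e1y : (∀ i j, ¬ S i j → x (.inr i) (.inr j) = 0) → (∀ i, x (.inl ()) (.inr i) = 0) →
      (F * x - x * F) (.inl ()) (.inr y) =
        F (.inl ()) (.inr y) * (x (.inr y) (.inr y) - x (.inl ()) (.inl ())) := fun hS h1 => by
    simp only [Matrix.sub_apply, Matrix.mul_apply, Fintype.sum_sum_type, h1, zero_mul,
      Finset.sum_const_zero, Fintype.sum_unique, add_zero]
    rw [Finset.sum_eq_single y]
    · change _ - x (.inl ()) (.inl ()) * F (.inl ()) _ = _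
      ring
    · intro k _ hk
      rw [hS k y fun h => hk (hSy k h), mul_zero]
    · simp
  have e11 : (∀ i, i ≠ y → x (.inr i) (.inl ()) = 0) → (∀ i, x (.inl ()) (.inr i) = 0) →
      (F * x - x * F) (.inl ()) (.inl ()) =
        F (.inl ()) (.inr y) * x (.inr y) (.inl ()) := fun h2 h1 => by
    simp only [Matrix.sub_apply, Matrix.mul_apply, Fintype.sum_sum_type, h1, zero_mul,
      Finset.sum_const_zero, Fintype.sum_unique, add_zero]
    rw [Finset.sum_eq_single y]
    · change F (.inl ()) (.inl ()) * x (.inl ()) (.inl ()) + _ -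
        x (.inl ()) (.inl ()) * F (.inl ()) (.inl ()) = _
      ring
    · intro k _ hk
      rw [h2 k hk, mul_zero]
    · simp
  constructor
  · rintro ⟨h1, h2⟩
    have h12 : x.toBlocks₁₂ = 0 := by ext i j; exact h1 _ _ id
    have h12' : ∀ i, x (.inl ()) (.inr i) = 0 := fun i => h1 _ _ id
    have hy1 : ∀ i, i ≠ y → x (.inr i) (.inl ()) = 0 := fun i hi => h1 (.inr i) (.inl ()) hi
    have hy0 : x (.inr y) (.inl ()) = 0 := by
      have := h2 (.inl ()) (.inl ()) trivial
      rw [e11 hy1 h12'] at this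
      exact (mul_eq_zero.1 this).resolve_left hF
    have h21 : x.toBlocks₂₁ = 0 := by
      ext i j
      by_cases hi : i = y
      · rw [hi]; exact hy0
      · exact hy1 i hi
    refine ⟨?_, h12, h21, fun i j h => h1 (.inr i) (.inr j) h, fun i j h => ?_⟩
    · have := h2 (.inr y) (.inl ()) rfl
      rw [e1y (fun i j h => h1 (.inr i) (.inr j) h) h12'] at this
      exact (sub_eq_zero.1 ((mul_eq_zero.1 this).resolve_left hF)).symm
    · rw [← e22 h12 h21]
      exact h2 (.inr i) (.inr j) h
  · rintro ⟨h0, h12, h21, h1, h2⟩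
    have h12' : ∀ i, x (.inl ()) (.inr i) = 0 := fun i => congrFun (congrFun h12 ()) i
    have h21' : ∀ i, x (.inr i) (.inl ()) = 0 := fun i => congrFun (congrFun h21 i) ()
    constructor
    · rintro (i | i) (j | j) h
      · exact absurd trivial h
      · exact h12' j
      · exact h21' i
      · exact h1 i j h
    · rintro (i | i) (j | j) h
      · change (F * x - x * F) (.inl ()) (.inl ()) = 0
        rw [e11 (fun i _ => h21' i) h12', h21', mul_zero]
      · exact h.elim
      · obtain rfl : i = y := h
        change (F * x - x * F) (.inl ()) (.inr i) = 0
        rw [e1y (fun i j h => h1 i j h) h12', h0, sub_self, mul_zero]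
      · rw [e22 h12 h21]
        exact h2 i j h

theorem finrank_matrixStabilizer_leafRel {S : M → M → Prop} {y : M} (hy : S y y)
    (hSy : ∀ i, S i y → i = y) {F : Matrix (Unit ⊕ M) (Unit ⊕ M) K}
    (hF : F (.inl ()) (.inr y) ≠ 0) : Module.finrank K (matrixStabilizer (leafRel S y) F) =
      Module.finrank K (matrixStabilizer S F.toBlocks₂₂) := by
  refine LinearEquiv.finrank_eq
    { toFun := fun x => ⟨_, ((mem_matrixStabilizer_leafRel hy hSy hF).1 x.2).2.2.2⟩
      map_add' := fun _ _ => rfl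
      map_smul' := fun _ _ => rfl
      invFun := fun p => ⟨Matrix.fromBlocks (Matrix.of fun _ _ => p.1 y y) 0 0 p.1,
        (mem_matrixStabilizer_leafRel hy hSy hF).2 (by simp)⟩
      left_inv := fun x => Subtype.ext ?_
      right_inv := fun p => Subtype.ext (by simp) }
  obtain ⟨h0, h12, h21, -⟩ := (mem_matrixStabilizer_leafRel hy hSy hF).1 x.2
  have h11 : x.1.toBlocks₁₁ = Matrix.of fun _ _ => x.1 (.inr y) (.inr y) := by
    ext i j
    exact h0
  conv_rhs => rw [← Matrix.fromBlocks_toBlocks x.1, h11, h12, h21]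
  rfl

theorem infinite_setOf_add_mul_ne_zero [CharZero K] (a b : K) (hb : b ≠ 0) :
    {t : K | a + t * b ≠ 0}.Infinite := by
  refine Set.Infinite.mono ?_ (Set.finite_singleton (-a / b)).infinite_compl
  intro t ht h
  refine ht ?_
  rw [Set.mem_singleton_iff, eq_div_iff hb]
  linear_combination h

theorem relIndex_leafRel [CharZero K] {S : M → M → Prop} {y : M} (hy : S y y)
    (hSy : ∀ i, S i y → i = y) : relIndex K (leafRel S y) = relIndex K S := by
  classical
  obtain ⟨F, hF⟩ := exists_relIndex_eq K S
  refine relIndex_eq (Matrix.fromBlocks 0 (Matrix.of fun _ _ => 1) 0 F) ?_ fun F => ?_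
  · rw [finrank_matrixStabilizer_leafRel hy hSy (by simp), Matrix.toBlocks_fromBlocks₂₂, hF]
  -- Only the entry of `F` dual to the new off-diagonal position has to be made nonzero.
  · refine le_finrank_matrixStabilizer_of_infinite F (Matrix.single (.inl ()) (.inr y) 1) ?_
    refine Set.Infinite.mono (fun t ht => ?_)
      (infinite_setOf_add_mul_ne_zero (F (.inl ()) (.inr y)) 1 one_ne_zero)
    rw [Set.mem_ofPred_eq, finrank_matrixStabilizer_leafRel hy hSy (by simpa using ht)]
    exact relIndex_le _ _

end

/-! ### Parabolic algebras with outer blocks of equal size. -/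

section
variable {K : Type*} [Field K] {U M V : Type*} [Fintype U] [Fintype M] [Fintype V]

/-- The inclusion of the middle block. -/
def midBlock (i : M) : U ⊕ M ⊕ V := .inr (.inl i)

/-- The inclusion of the last block. -/
def lastBlock (i : V) : U ⊕ M ⊕ V := .inr (.inr i)

/-- The entries in the first, middle and last block of rows and columns. -/
def threeBlocks (a₁₁ : Matrix U U K) (a₁₂ : Matrix U M K) (a₁₃ : Matrix U V K)
    (a₂₁ : Matrix M U K) (a₂₂ : Matrix M M K) (a₂₃ : Matrix M V K)
    (a₃₁ : Matrix V U K) (a₃₂ : Matrix V M K) (a₃₃ : Matrix V V K) :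
    Matrix (U ⊕ M ⊕ V) (U ⊕ M ⊕ V) K :=
  Matrix.of fun
    | .inl i, .inl j => a₁₁ i j
    | .inl i, .inr (.inl j) => a₁₂ i j
    | .inl i, .inr (.inr j) => a₁₃ i j
    | .inr (.inl i), .inl j => a₂₁ i j
    | .inr (.inl i), .inr (.inl j) => a₂₂ i j
    | .inr (.inl i), .inr (.inr j) => a₂₃ i j
    | .inr (.inr i), .inl j => a₃₁ i j
    | .inr (.inr i), .inr (.inl j) => a₃₂ i j
    | .inr (.inr i), .inr (.inr j) => a₃₃ i j

/-- The relation in which the first block precedes the middle one, ordered by `S`, which precedes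
the last block, with additional relations between all of the last block and the points of `Q`. -/
def cornerRel (S : M → M → Prop) (Q : M → Prop) : U ⊕ M ⊕ V → U ⊕ M ⊕ V → Prop
  | .inl _, _ => True
  | .inr (.inl _), .inl _ => False
  | .inr (.inl i), .inr (.inl j) => S i j
  | .inr (.inl _), .inr (.inr _) => True
  | .inr (.inr _), .inl _ => False
  | .inr (.inr _), .inr (.inl j) => Q j
  | .inr (.inr _), .inr (.inr _) => True

theorem mul_submatrix_three {α β : Type*} (A B : Matrix (U ⊕ M ⊕ V) (U ⊕ M ⊕ V) K)
    (f : α → U ⊕ M ⊕ V) (g : β → U ⊕ M ⊕ V) :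
    (A * B).submatrix f g = A.submatrix f Sum.inl * B.submatrix Sum.inl g +
      A.submatrix f midBlock * B.submatrix midBlock g +
      A.submatrix f lastBlock * B.submatrix lastBlock g := by
  ext i j
  simp only [Matrix.submatrix_apply, Matrix.mul_apply, Fintype.sum_sum_type, Matrix.add_apply,
    midBlock, lastBlock, add_assoc]

omit [Field K] [Fintype U] [Fintype M] [Fintype V] in
theorem ext_three {x z : Matrix (U ⊕ M ⊕ V) (U ⊕ M ⊕ V) K}
    (h₁₁ : x.submatrix Sum.inl Sum.inl = z.submatrix Sum.inl Sum.inl)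
    (h₁₂ : x.submatrix Sum.inl midBlock = z.submatrix Sum.inl midBlock)
    (h₁₃ : x.submatrix Sum.inl lastBlock = z.submatrix Sum.inl lastBlock)
    (h₂₁ : x.submatrix midBlock Sum.inl = z.submatrix midBlock Sum.inl)
    (h₂₂ : x.submatrix midBlock midBlock = z.submatrix midBlock midBlock)
    (h₂₃ : x.submatrix midBlock lastBlock = z.submatrix midBlock lastBlock)
    (h₃₁ : x.submatrix lastBlock Sum.inl = z.submatrix lastBlock Sum.inl)
    (h₃₂ : x.submatrix lastBlock midBlock = z.submatrix lastBlock midBlock)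
    (h₃₃ : x.submatrix lastBlock lastBlock = z.submatrix lastBlock lastBlock) : x = z := by
  ext (i | i | i) (j | j | j)
  · exact congrFun (congrFun h₁₁ i) j
  · exact congrFun (congrFun h₁₂ i) j
  · exact congrFun (congrFun h₁₃ i) j
  · exact congrFun (congrFun h₂₁ i) j
  · exact congrFun (congrFun h₂₂ i) j
  · exact congrFun (congrFun h₂₃ i) j
  · exact congrFun (congrFun h₃₁ i) j
  · exact congrFun (congrFun h₃₂ i) j
  · exact congrFun (congrFun h₃₃ i) j

theorem mem_matrixStabilizer_cornerRel {S : M → M → Prop} {Q : M → Prop}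
    {F x : Matrix (U ⊕ M ⊕ V) (U ⊕ M ⊕ V) K} :
    x ∈ matrixStabilizer (cornerRel S Q) F ↔
      (x.submatrix midBlock Sum.inl = 0 ∧ x.submatrix lastBlock Sum.inl = 0 ∧
        (∀ i j, ¬ Q j → x.submatrix lastBlock midBlock i j = 0) ∧
        ∀ i j, ¬ S i j → x.submatrix midBlock midBlock i j = 0) ∧
      (F * x - x * F).submatrix lastBlock Sum.inl = 0 ∧
      (F * x - x * F).submatrix lastBlock midBlock = 0 ∧
      (F * x - x * F).submatrix midBlock Sum.inl = 0 ∧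
      (F * x - x * F).submatrix Sum.inl Sum.inl = 0 ∧
      (∀ i j, S i j → (F * x - x * F).submatrix midBlock midBlock j i = 0) ∧
      (F * x - x * F).submatrix lastBlock lastBlock = 0 ∧
      ∀ i j, Q j → (F * x - x * F).submatrix midBlock lastBlock j i = 0 := by
  rw [mem_matrixStabilizer]
  generalize F * x - x * F = Z
  constructor
  · rintro ⟨h1, h2⟩
    refine ⟨⟨?_, ?_, fun i j h => h1 (.inr (.inr i)) (.inr (.inl j)) h,
      fun i j h => h1 (.inr (.inl i)) (.inr (.inl j)) h⟩, ?_, ?_, ?_, ?_,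
      fun i j h => h2 (.inr (.inl i)) (.inr (.inl j)) h, ?_,
      fun i j h => h2 (.inr (.inr i)) (.inr (.inl j)) h⟩
    · ext i j; exact h1 (.inr (.inl i)) (.inl j) id
    · ext i j; exact h1 (.inr (.inr i)) (.inl j) id
    · ext i j; exact h2 (.inl j) (.inr (.inr i)) trivial
    · ext i j; exact h2 (.inr (.inl j)) (.inr (.inr i)) trivial
    · ext i j; exact h2 (.inl j) (.inr (.inl i)) trivial
    · ext i j; exact h2 (.inl j) (.inl i) trivial
    · ext i j; exact h2 (.inr (.inr j)) (.inr (.inr i)) trivial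
  · rintro ⟨⟨h21, h31, h32, h22⟩, z31, z32, z21, z11, z22, z33, z23⟩
    constructor
    · rintro (i | i | i) (j | j | j) h
      · exact absurd trivial h
      · exact absurd trivial h
      · exact absurd trivial h
      · exact congrFun (congrFun h21 i) j
      · exact h22 i j h
      · exact absurd trivial h
      · exact congrFun (congrFun h31 i) j
      · exact h32 i j h
      · exact absurd trivial h
    · rintro (i | i | i) (j | j | j) h
      · exact congrFun (congrFun z11 j) i
      · exact congrFun (congrFun z21 j) i
      · exact congrFun (congrFun z31 j) i
      · exact h.elim
      · exact z22 i j h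
      · exact congrFun (congrFun z32 j) i
      · exact h.elim
      · exact z23 i j h
      · exact congrFun (congrFun z33 j) i

theorem mem_matrixStabilizer_true {F x : Matrix V V K} :
    x ∈ matrixStabilizer (fun _ _ => True) F ↔ F * x - x * F = 0 := by
  rw [mem_matrixStabilizer]
  constructor
  · rintro ⟨-, h⟩
    ext i j
    exact h j i trivial
  · intro h
    exact ⟨fun i j h => absurd trivial h, fun i j _ => by rw [h]; rfl⟩

/-- The lower left block of `F` is dual to the upper right block of `x`; once it is invertible, with
inverse `c`, the equations determine the blocks `11`, `12`, `23`, `13` of `x` from `x22` and `x33`.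
What remains decouples: `x22` stabilizes the Schur complement `F22 - F21 c F32`, and `x33`
centralizes a matrix of the size of the corner. -/
theorem mem_matrixStabilizer_cornerRel_false [DecidableEq U] [DecidableEq V] {S : M → M → Prop}
    {F x : Matrix (U ⊕ M ⊕ V) (U ⊕ M ⊕ V) K} {c : Matrix U V K}
    (hc : c * F.submatrix lastBlock Sum.inl = 1) (hc' : F.submatrix lastBlock Sum.inl * c = 1) :
    x ∈ matrixStabilizer (cornerRel S fun _ => False) F ↔
      (x.submatrix midBlock Sum.inl = 0 ∧ x.submatrix lastBlock Sum.inl = 0 ∧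
        x.submatrix lastBlock midBlock = 0) ∧
      (x.submatrix Sum.inl Sum.inl =
        c * x.submatrix lastBlock lastBlock * F.submatrix lastBlock Sum.inl ∧
      x.submatrix Sum.inl midBlock = c *
        (x.submatrix lastBlock lastBlock * F.submatrix lastBlock midBlock -
          F.submatrix lastBlock midBlock * x.submatrix midBlock midBlock) ∧
      x.submatrix midBlock lastBlock =
        (F.submatrix midBlock Sum.inl * x.submatrix Sum.inl Sum.inl -
          x.submatrix midBlock midBlock * F.submatrix midBlock Sum.inl) * c ∧
      x.submatrix Sum.inl lastBlock =
        (F.submatrix Sum.inl Sum.inl * x.submatrix Sum.inl Sum.inl -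
          x.submatrix Sum.inl Sum.inl * F.submatrix Sum.inl Sum.inl -
          x.submatrix Sum.inl midBlock * F.submatrix midBlock Sum.inl) * c) ∧
      x.submatrix midBlock midBlock ∈ matrixStabilizer S (F.submatrix midBlock midBlock -
        F.submatrix midBlock Sum.inl * c * F.submatrix lastBlock midBlock) ∧
      x.submatrix lastBlock lastBlock ∈ matrixStabilizer (fun _ _ => True)
        (F.submatrix lastBlock Sum.inl * F.submatrix Sum.inl Sum.inl * c +
          F.submatrix lastBlock lastBlock +
          F.submatrix lastBlock midBlock * F.submatrix midBlock Sum.inl * c) := by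
  rw [mem_matrixStabilizer_cornerRel, mem_matrixStabilizer, mem_matrixStabilizer_true]
  simp only [Matrix.submatrix_sub, Pi.sub_apply, mul_submatrix_three]
  generalize x.submatrix Sum.inl Sum.inl = x11
  generalize x.submatrix Sum.inl midBlock = x12
  generalize x.submatrix Sum.inl lastBlock = x13
  generalize x.submatrix midBlock Sum.inl = x21
  generalize x.submatrix midBlock midBlock = x22
  generalize x.submatrix midBlock lastBlock = x23
  generalize x.submatrix lastBlock Sum.inl = x31
  generalize x.submatrix lastBlock midBlock = x32
  generalize x.submatrix lastBlock lastBlock = x33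
  generalize F.submatrix Sum.inl Sum.inl = F11
  generalize F.submatrix Sum.inl midBlock = F12
  generalize F.submatrix Sum.inl lastBlock = F13
  generalize F.submatrix midBlock Sum.inl = F21
  generalize F.submatrix midBlock midBlock = F22
  generalize F.submatrix midBlock lastBlock = F23
  generalize hφ : F.submatrix lastBlock Sum.inl = φ at hc hc' ⊢
  generalize F.submatrix lastBlock midBlock = F32
  generalize F.submatrix lastBlock lastBlock = F33
  have cU : ∀ X : Matrix U U K, c * (φ * X) = X := fun X => by
    rw [← Matrix.mul_assoc, hc, Matrix.one_mul]
  have cM : ∀ X : Matrix U M K, c * (φ * X) = X := fun X => by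
    rw [← Matrix.mul_assoc, hc, Matrix.one_mul]
  have cV : ∀ X : Matrix U V K, c * (φ * X) = X := fun X => by
    rw [← Matrix.mul_assoc, hc, Matrix.one_mul]
  have dU : ∀ X : Matrix V U K, φ * (c * X) = X := fun X => by
    rw [← Matrix.mul_assoc, hc', Matrix.one_mul]
  have dM : ∀ X : Matrix V M K, φ * (c * X) = X := fun X => by
    rw [← Matrix.mul_assoc, hc', Matrix.one_mul]
  have dV : ∀ X : Matrix V V K, φ * (c * X) = X := fun X => by
    rw [← Matrix.mul_assoc, hc', Matrix.one_mul]
  -- After elimination the terms with `x33` cancel, leaving the commutator of `x22` with the Schur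
  -- complement.
  have k22 : x11 = c * x33 * φ → x12 = c * (x33 * F32 - F32 * x22) →
      x23 = (F21 * x11 - x22 * F21) * c →
      F21 * x12 + F22 * x22 - (x22 * F22 + x23 * F32) =
        (F22 - F21 * c * F32) * x22 - x22 * (F22 - F21 * c * F32) := by
    rintro e11 e12 e23
    rw [e23, e12, e11]
    simp only [Matrix.mul_sub, Matrix.sub_mul, Matrix.mul_assoc, hc', Matrix.mul_one]
    abel
  -- Here the terms with `x22` cancel instead.
  have k33 : x11 = c * x33 * φ → x12 = c * (x33 * F32 - F32 * x22) →
      x23 = (F21 * x11 - x22 * F21) * c →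
      x13 = (F11 * x11 - x11 * F11 - x12 * F21) * c →
      φ * x13 + F32 * x23 + F33 * x33 - x33 * F33 =
        (φ * F11 * c + F33 + F32 * F21 * c) * x33 -
          x33 * (φ * F11 * c + F33 + F32 * F21 * c) := by
    rintro e11 e12 e23 e13
    rw [e13, e23, e12, e11]
    simp only [Matrix.mul_sub, Matrix.sub_mul, Matrix.mul_add, Matrix.add_mul, Matrix.mul_assoc,
      dV, hc', Matrix.mul_one]
    abel
  constructor
  · rintro ⟨⟨h21, h31, h32, h22⟩, z31, z32, z21, z11, z22, z33, -⟩
    have h32 : x32 = 0 := by ext i j; exact h32 i j id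
    subst h21 h31 h32
    simp only [Matrix.mul_zero, Matrix.zero_mul, add_zero, zero_add] at z31 z32 z21 z11 z22 z33
    have e11 : x11 = c * x33 * φ := by
      rw [Matrix.mul_assoc, ← sub_eq_zero.1 z31, cU]
    have e12 : x12 = c * (x33 * F32 - F32 * x22) := by
      rw [← sub_eq_zero.1 z32, add_sub_cancel_right, cM]
    have e23 : x23 = (F21 * x11 - x22 * F21) * c := by
      rw [sub_eq_zero.1 z21, add_sub_cancel_left, Matrix.mul_assoc, hc', Matrix.mul_one]
    have e13 : x13 = (F11 * x11 - x11 * F11 - x12 * F21) * c := by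
      rw [sub_eq_zero.1 z11, sub_sub, add_sub_cancel_left, Matrix.mul_assoc, hc', Matrix.mul_one]
    refine ⟨⟨rfl, rfl, rfl⟩, ⟨e11, e12, e23, e13⟩, ⟨h22, fun i j h => ?_⟩, ?_⟩
    · rw [← k22 e11 e12 e23]
      exact z22 i j h
    · rw [← k33 e11 e12 e23 e13, z33]
  · rintro ⟨⟨h21, h31, h32⟩, ⟨e11, e12, e23, e13⟩, ⟨h22, z22⟩, z33⟩
    subst h21 h31 h32
    simp only [Matrix.mul_zero, Matrix.zero_mul, add_zero, zero_add]
    refine ⟨⟨trivial, trivial, fun _ _ _ => rfl, h22⟩, ?_, ?_, ?_, ?_, fun i j h => ?_, ?_,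
      fun _ _ h => h.elim⟩
    · rw [e11, Matrix.mul_assoc, dU, sub_self]
    · rw [e12, dM]; abel
    · rw [e23, Matrix.mul_assoc, hc, Matrix.mul_one]; abel
    · rw [e13, Matrix.mul_assoc, hc, Matrix.mul_one]; abel
    · rw [k22 e11 e12 e23]
      exact z22 i j h
    · rw [k33 e11 e12 e23 e13, z33]

theorem finrank_matrixStabilizer_cornerRel_false [DecidableEq U] [DecidableEq V]
    {S : M → M → Prop} {F : Matrix (U ⊕ M ⊕ V) (U ⊕ M ⊕ V) K} {c : Matrix U V K}
    (hc : c * F.submatrix lastBlock Sum.inl = 1) (hc' : F.submatrix lastBlock Sum.inl * c = 1) :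
    Module.finrank K (matrixStabilizer (cornerRel S fun _ => False) F) =
      Module.finrank K (matrixStabilizer S (F.submatrix midBlock midBlock -
        F.submatrix midBlock Sum.inl * c * F.submatrix lastBlock midBlock)) +
      Module.finrank K (matrixStabilizer (fun _ _ => True)
        (F.submatrix lastBlock Sum.inl * F.submatrix Sum.inl Sum.inl * c +
          F.submatrix lastBlock lastBlock +
          F.submatrix lastBlock midBlock * F.submatrix midBlock Sum.inl * c)) := by
  rw [← Module.finrank_prod]
  refine LinearEquiv.finrank_eq (LinearEquiv.ofBijective
    { toFun := fun x => (⟨_, ((mem_matrixStabilizer_cornerRel_false hc hc').1 x.2).2.2.1⟩,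
        ⟨_, ((mem_matrixStabilizer_cornerRel_false hc hc').1 x.2).2.2.2⟩)
      map_add' := fun _ _ => rfl
      map_smul' := fun _ _ => rfl } ⟨?_, ?_⟩)
  · intro x z hxz
    obtain ⟨⟨x21, x31, x32⟩, ⟨x11, x12, x23, x13⟩, -⟩ :=
      (mem_matrixStabilizer_cornerRel_false hc hc').1 x.2
    obtain ⟨⟨z21, z31, z32⟩, ⟨z11, z12, z23, z13⟩, -⟩ :=
      (mem_matrixStabilizer_cornerRel_false hc hc').1 z.2
    have h22 : x.1.submatrix midBlock midBlock = z.1.submatrix midBlock midBlock :=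
      congrArg (fun p => p.1.1) hxz
    have h33 : x.1.submatrix lastBlock lastBlock = z.1.submatrix lastBlock lastBlock :=
      congrArg (fun p => p.2.1) hxz
    have h11 : x.1.submatrix Sum.inl Sum.inl = z.1.submatrix Sum.inl Sum.inl := by
      rw [x11, z11, h33]
    have h12 : x.1.submatrix Sum.inl midBlock = z.1.submatrix Sum.inl midBlock := by
      rw [x12, z12, h22, h33]
    refine Subtype.ext (ext_three h11 h12 ?_ (x21.trans z21.symm) h22 ?_ (x31.trans z31.symm)
      (x32.trans z32.symm) h33)
    · rw [x13, z13, h11, h12]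
    · rw [x23, z23, h11, h22]
  · rintro ⟨⟨x22, h22⟩, ⟨x33, h33⟩⟩
    let x11 := c * x33 * F.submatrix lastBlock Sum.inl
    let x12 := c * (x33 * F.submatrix lastBlock midBlock - F.submatrix lastBlock midBlock * x22)
    exact ⟨⟨threeBlocks x11 x12 ((F.submatrix Sum.inl Sum.inl * x11 -
      x11 * F.submatrix Sum.inl Sum.inl - x12 * F.submatrix midBlock Sum.inl) * c) 0 x22
      ((F.submatrix midBlock Sum.inl * x11 - x22 * F.submatrix midBlock Sum.inl) * c) 0 0 x33,
      (mem_matrixStabilizer_cornerRel_false hc hc').2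
        ⟨⟨rfl, rfl, rfl⟩, ⟨rfl, rfl, rfl, rfl⟩, h22, h33⟩⟩, rfl⟩

/-- The determinant vanishes only when `-t` is an eigenvalue of `A`. -/
theorem infinite_setOf_isUnit_det [CharZero K] [DecidableEq U] (A : Matrix U U K) :
    {t : K | IsUnit (A + t • (1 : Matrix U U K)).det}.Infinite := by
  refine Set.Infinite.mono ?_ (A.finite_spectrum.preimage
    (neg_injective (G := K)).injOn).infinite_compl
  intro t ht
  by_contra h
  refine ht fun hu => h ?_
  rw [Set.mem_ofPred_eq, ← Matrix.isUnit_iff_isUnit_det]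
  have : A + t • (1 : Matrix U U K) = -(algebraMap K (Matrix U U K) (-t) - A) := by
    rw [Algebra.algebraMap_eq_smul_one, neg_smul]
    abel
  rw [this]
  exact hu.neg

theorem relIndex_cornerRel [CharZero K] [DecidableEq U] (S : M → M → Prop) :
    relIndex K (cornerRel S (fun _ => False) : U ⊕ M ⊕ U → U ⊕ M ⊕ U → Prop) =
      relIndex K S + relIndex K (fun _ _ : U => True) := by
  obtain ⟨F, hF⟩ := exists_relIndex_eq K S
  obtain ⟨G, hG⟩ := exists_relIndex_eq K (fun _ _ : U => True)
  -- With identity corner and vanishing blocks next to it, the two decoupled problems are exactly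
  -- those of the optimal `F` and `G`.
  refine relIndex_eq (threeBlocks 0 0 0 0 F 0 1 0 G) ?_ fun F => ?_
  · have h31 : (threeBlocks 0 0 0 0 F 0 1 0 G).submatrix lastBlock Sum.inl = (1 : Matrix U U K) :=
      rfl
    have h22 : (F : Matrix M M K) - (0 : Matrix M U K) * (1 : Matrix U U K) * (0 : Matrix U M K) =
        F := by simp
    have h33 : (1 : Matrix U U K) * (0 : Matrix U U K) * (1 : Matrix U U K) + G +
        (0 : Matrix U M K) * (0 : Matrix M U K) * (1 : Matrix U U K) = G := by simp
    refine (finrank_matrixStabilizer_cornerRel_false (c := 1) (by rw [h31, mul_one])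
      (by rw [h31, mul_one])).trans ?_
    rw [← hF, ← hG]
    conv_rhs => rw [← h22, ← h33]
    rfl
  · refine le_finrank_matrixStabilizer_of_infinite F (threeBlocks 0 0 0 0 0 0 1 0 0) ?_
    refine Set.Infinite.mono ?_ (infinite_setOf_isUnit_det (F.submatrix lastBlock Sum.inl))
    intro t ht
    rw [Set.mem_ofPred_eq] at ht ⊢
    have h31 : (F + t • threeBlocks 0 0 0 0 0 0 1 0 0).submatrix lastBlock Sum.inl =
      F.submatrix lastBlock Sum.inl + t • (1 : Matrix U U K) := rfl
    rw [← h31] at ht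
    rw [finrank_matrixStabilizer_cornerRel_false (Matrix.nonsing_inv_mul _ ht)
      (Matrix.mul_nonsing_inv _ ht)]
    exact add_le_add (relIndex_le _ _) (relIndex_le _ _)

end

/-! ### Parabolic algebras with outer blocks of sizes 1 and 2. -/

section
variable {K : Type*} [Field K] {M : Type*} [Fintype M]

theorem unit_matrix_mul_comm (A B : Matrix Unit Unit K) : A * B = B * A := by
  ext i j
  simp [Matrix.mul_apply, mul_comm]

/-- Here `y` is the last point of the middle part and forms a block of size two with the final
point, so `x32` may be nonzero at `y`. Put `v = (F22 - F21 F32) F21 + F23 - F21 F33`. If `v y ≠ 0`,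
the middle equations force `x32 = 0`, and the equation dual to the extra position forces `x33` to
equal the entry of `x22` at `(y, y)`. Unlike in the case without extra position, the corner leaves
no free parameter. -/
theorem mem_matrixStabilizer_cornerRel_eq [DecidableEq M] {S : M → M → Prop} {y : M}
    (hrefl : ∀ i, S i i) (hy : ∀ i, S i y) (hSy : ∀ i, S y i → i = y)
    {F x : Matrix (Unit ⊕ M ⊕ Unit) (Unit ⊕ M ⊕ Unit) K}
    (hφ : F.submatrix lastBlock Sum.inl = 1)
    (hv : ((F.submatrix midBlock midBlock -
      F.submatrix midBlock Sum.inl * F.submatrix lastBlock midBlock) * F.submatrix midBlock Sum.inl +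
      F.submatrix midBlock lastBlock - F.submatrix midBlock Sum.inl *
        F.submatrix lastBlock lastBlock) y () ≠ 0) :
    x ∈ matrixStabilizer (cornerRel S fun j => j = y) F ↔
      (x.submatrix midBlock Sum.inl = 0 ∧ x.submatrix lastBlock Sum.inl = 0 ∧
        x.submatrix lastBlock midBlock = 0) ∧
      (x.submatrix Sum.inl Sum.inl = x.submatrix lastBlock lastBlock ∧
      x.submatrix Sum.inl midBlock =
        x.submatrix lastBlock lastBlock * F.submatrix lastBlock midBlock -
          F.submatrix lastBlock midBlock * x.submatrix midBlock midBlock ∧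
      x.submatrix midBlock lastBlock =
        F.submatrix midBlock Sum.inl * x.submatrix lastBlock lastBlock -
          x.submatrix midBlock midBlock * F.submatrix midBlock Sum.inl ∧
      x.submatrix Sum.inl lastBlock =
        - (x.submatrix Sum.inl midBlock * F.submatrix midBlock Sum.inl)) ∧
      x.submatrix lastBlock lastBlock = Matrix.of (fun _ _ => x.submatrix midBlock midBlock y y) ∧
      x.submatrix midBlock midBlock ∈ matrixStabilizer S (F.submatrix midBlock midBlock -
        F.submatrix midBlock Sum.inl * F.submatrix lastBlock midBlock) := by
  rw [mem_matrixStabilizer_cornerRel, mem_matrixStabilizer]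
  simp only [Matrix.submatrix_sub, Pi.sub_apply, mul_submatrix_three, hφ]
  generalize x.submatrix Sum.inl Sum.inl = x11
  generalize x.submatrix Sum.inl midBlock = x12
  generalize x.submatrix Sum.inl lastBlock = x13
  generalize x.submatrix midBlock Sum.inl = x21
  generalize x.submatrix midBlock midBlock = x22
  generalize x.submatrix midBlock lastBlock = x23
  generalize x.submatrix lastBlock Sum.inl = x31
  generalize x.submatrix lastBlock midBlock = b
  generalize x.submatrix lastBlock lastBlock = x33
  generalize F.submatrix Sum.inl Sum.inl = A
  generalize F.submatrix Sum.inl midBlock = F12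
  generalize F.submatrix Sum.inl lastBlock = F13
  generalize F.submatrix midBlock Sum.inl = B at hv ⊢
  generalize F.submatrix midBlock midBlock = C at hv ⊢
  generalize F.submatrix midBlock lastBlock = G at hv ⊢
  generalize F.submatrix lastBlock midBlock = D at hv ⊢
  generalize F.submatrix lastBlock lastBlock = E at hv ⊢
  have k22 : x11 = b * B + x33 → x12 = b * C + x33 * D - D * x22 - E * b →
      x23 = B * x11 - x22 * B →
      B * x12 + C * x22 + G * b - (x22 * C + x23 * D) =
        ((C - B * D) * (x22 - B * b) - (x22 - B * b) * (C - B * D)) +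
          ((C - B * D) * B + G - B * E) * b := by
    rintro rfl rfl rfl
    simp only [Matrix.mul_sub, Matrix.sub_mul, Matrix.mul_add, Matrix.add_mul, Matrix.mul_assoc]
    abel
  have k23 : x12 = x33 * D - D * x22 → x23 = B * x33 - x22 * B → x13 = - (x12 * B) →
      B * x13 + C * x23 + G * x33 - (x22 * G + x23 * E) =
        ((C - B * D) * B + G - B * E) * x33 - ((C - B * D) * x22 - x22 * (C - B * D)) * B
          - x22 * ((C - B * D) * B + G - B * E) := by
    rintro rfl rfl rfl
    have h1 : B * (E * x33) = B * (x33 * E) := by rw [unit_matrix_mul_comm E]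
    have h2 : B * (D * (B * x33)) = B * (x33 * (D * B)) := by
      rw [← Matrix.mul_assoc D, unit_matrix_mul_comm (D * B)]
    simp only [Matrix.mul_sub, Matrix.sub_mul, Matrix.mul_add, Matrix.add_mul, Matrix.mul_assoc,
      Matrix.mul_neg, h1, h2]
    abel
  have k33 : x12 = x33 * D - D * x22 → x23 = B * x33 - x22 * B → x13 = - (x12 * B) →
      x13 + D * x23 + E * x33 - x33 * E = 0 := by
    rintro rfl rfl rfl
    have h1 : E * x33 = x33 * E := unit_matrix_mul_comm _ _
    have h2 : D * (B * x33) = x33 * (D * B) := by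
      rw [← Matrix.mul_assoc D, unit_matrix_mul_comm (D * B)]
    simp only [Matrix.mul_sub, Matrix.sub_mul, Matrix.mul_assoc, h1, h2]
    abel
  -- In row `y` the commutator vanishes because every `i` is related to `y`, and `x22` has only its
  -- diagonal entry because `y` is related to itself alone.
  have kv : (∀ i j, ¬ S i j → x22 i j = 0) →
      (∀ i j, S i j → ((C - B * D) * x22 - x22 * (C - B * D)) j i = 0) →
      (((C - B * D) * B + G - B * E) * x33 - ((C - B * D) * x22 - x22 * (C - B * D)) * B
          - x22 * ((C - B * D) * B + G - B * E)) y () =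
        ((C - B * D) * B + G - B * E) y () * (x33 () () - x22 y y) := by
    intro h22 hZ
    generalize ((C - B * D) * B + G - B * E) = v
    generalize (C - B * D) * x22 - x22 * (C - B * D) = Z at hZ ⊢
    rw [Matrix.sub_apply, Matrix.sub_apply, Matrix.mul_apply, Matrix.mul_apply, Matrix.mul_apply,
      Finset.sum_eq_zero (f := fun j => Z y j * B j ()) fun j _ => by rw [hZ j y (hy j), zero_mul],
      Finset.sum_eq_single (f := fun j => x22 y j * v j ()) y
        (fun j _ hj => by rw [h22 y j fun h => hj (hSy j h), zero_mul]) (by simp)]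
    simp only [Fintype.sum_unique]
    change v y () * x33 () () - 0 - _ = _
    ring
  constructor
  · rintro ⟨⟨h21, h31, hb, h22⟩, z31, z32, z21, z11, z22, z33, z23⟩
    subst h21 h31
    simp only [Matrix.mul_zero, Matrix.zero_mul, add_zero, zero_add, Matrix.one_mul,
      Matrix.mul_one] at z31 z32 z21 z11 z22 z33 z23
    have e11 : x11 = b * B + x33 := sub_eq_zero.1 z31
    have e12 : x12 = b * C + x33 * D - D * x22 - E * b := by
      rw [← sub_eq_zero, ← z32]; abel
    have e23 : x23 = B * x11 - x22 * B := by
      rw [← sub_eq_zero, ← neg_eq_zero, ← z21]; abel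
    -- Taking the trace of the middle equations, which is possible as all diagonal positions are
    -- allowed, removes the commutator and leaves `b y * v y = 0`.
    have hb0 : b = 0 := by
      have htr : (((C - B * D) * (x22 - B * b) - (x22 - B * b) * (C - B * D)) +
          ((C - B * D) * B + G - B * E) * b).trace = 0 := by
        refine Finset.sum_eq_zero fun i _ => ?_
        rw [← k22 e11 e12 e23]
        exact z22 i i (hrefl i)
      rw [Matrix.trace_add, Matrix.trace_sub, Matrix.trace_mul_comm, sub_self, zero_add,
        Matrix.trace_mul_comm] at htr
      generalize (C - B * D) * B + G - B * E = v at hv htr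
      have hbv : (b * v).trace = b () y * v y () := by
        simp only [Matrix.trace, Fintype.sum_unique, Matrix.diag_apply, Matrix.mul_apply]
        exact Finset.sum_eq_single y
          (fun j _ hj => by rw [show b default j = 0 from hb () j hj, zero_mul]) (by simp)
      ext i j
      by_cases hj : j = y
      · rw [hj]
        exact (mul_eq_zero.1 (hbv.symm.trans htr)).resolve_right hv
      · exact hb i j hj
    subst hb0
    simp only [Matrix.mul_zero, Matrix.zero_mul, add_zero, zero_add,
      sub_zero] at e11 e12 z22 z33
    subst e11
    have e13 : x13 = - (x12 * B) := by
      rw [unit_matrix_mul_comm A] at z11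
      rw [← sub_eq_zero, ← neg_eq_zero, ← z11]; abel
    have k22' := k22 (by simp) (by rw [e12]; simp) e23
    simp only [Matrix.mul_zero, add_zero, sub_zero] at k22'
    have hZ : ∀ i j, S i j → ((C - B * D) * x22 - x22 * (C - B * D)) j i = 0 := fun i j h => by
      rw [← k22']
      exact z22 i j h
    refine ⟨⟨rfl, rfl, rfl⟩, ⟨rfl, e12, e23, e13⟩, ?_, h22, hZ⟩
    have h23 := z23 () y rfl
    rw [k23 e12 e23 e13, kv h22 hZ] at h23
    ext i j
    exact sub_eq_zero.1 ((mul_eq_zero.1 h23).resolve_left hv)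
  · rintro ⟨⟨h21, h31, h32⟩, ⟨e11, e12, e23, e13⟩, e33, ⟨h22, hZ⟩⟩
    subst h21 h31 h32 e11
    simp only [Matrix.mul_zero, Matrix.zero_mul, add_zero, zero_add, Matrix.one_mul,
      Matrix.mul_one]
    have k22' := k22 (by simp) (by rw [e12]; simp) e23
    simp only [Matrix.mul_zero, add_zero, sub_zero] at k22'
    refine ⟨⟨trivial, trivial, fun _ _ _ => rfl, h22⟩, sub_self _, ?_, ?_, ?_, fun i j h => ?_,
      k33 e12 e23 e13, ?_⟩
    · rw [e12]; abel
    · rw [e23]; abel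
    · rw [e13, unit_matrix_mul_comm A]; abel
    · rw [k22']
      exact hZ i j h
    · rintro i j rfl
      rw [k23 e12 e23 e13]
      refine (kv h22 hZ).trans ?_
      rw [e33, Matrix.of_apply, sub_self, mul_zero]

theorem finrank_matrixStabilizer_cornerRel_eq [DecidableEq M] {S : M → M → Prop} {y : M}
    (hrefl : ∀ i, S i i) (hy : ∀ i, S i y) (hSy : ∀ i, S y i → i = y)
    {F : Matrix (Unit ⊕ M ⊕ Unit) (Unit ⊕ M ⊕ Unit) K}
    (hφ : F.submatrix lastBlock Sum.inl = 1)
    (hv : ((F.submatrix midBlock midBlock -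
      F.submatrix midBlock Sum.inl * F.submatrix lastBlock midBlock) * F.submatrix midBlock Sum.inl +
      F.submatrix midBlock lastBlock - F.submatrix midBlock Sum.inl *
        F.submatrix lastBlock lastBlock) y () ≠ 0) :
    Module.finrank K (matrixStabilizer (cornerRel S fun j => j = y) F) =
      Module.finrank K (matrixStabilizer S (F.submatrix midBlock midBlock -
        F.submatrix midBlock Sum.inl * F.submatrix lastBlock midBlock)) := by
  refine LinearEquiv.finrank_eq (LinearEquiv.ofBijective
    { toFun := fun x => ⟨_, ((mem_matrixStabilizer_cornerRel_eq hrefl hy hSy hφ hv).1 x.2).2.2.2⟩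
      map_add' := fun _ _ => rfl
      map_smul' := fun _ _ => rfl } ⟨?_, ?_⟩)
  · intro x z hxz
    obtain ⟨⟨x21, x31, x32⟩, ⟨x11, x12, x23, x13⟩, x33, -⟩ :=
      (mem_matrixStabilizer_cornerRel_eq hrefl hy hSy hφ hv).1 x.2
    obtain ⟨⟨z21, z31, z32⟩, ⟨z11, z12, z23, z13⟩, z33, -⟩ :=
      (mem_matrixStabilizer_cornerRel_eq hrefl hy hSy hφ hv).1 z.2
    have h22 : x.1.submatrix midBlock midBlock = z.1.submatrix midBlock midBlock :=
      congrArg Subtype.val hxz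
    have h33 : x.1.submatrix lastBlock lastBlock = z.1.submatrix lastBlock lastBlock := by
      rw [x33, z33, h22]
    have h12 : x.1.submatrix Sum.inl midBlock = z.1.submatrix Sum.inl midBlock := by
      rw [x12, z12, h22, h33]
    refine Subtype.ext (ext_three ?_ h12 ?_ (x21.trans z21.symm) h22 ?_ (x31.trans z31.symm)
      (x32.trans z32.symm) h33)
    · rw [x11, z11, h33]
    · rw [x13, z13, h12]
    · rw [x23, z23, h22, h33]
  · rintro ⟨x22, h22⟩
    let x33 : Matrix Unit Unit K := Matrix.of fun _ _ => x22 y y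
    let x12 := x33 * F.submatrix lastBlock midBlock - F.submatrix lastBlock midBlock * x22
    exact ⟨⟨threeBlocks x33 x12 (-(x12 * F.submatrix midBlock Sum.inl)) 0 x22
      (F.submatrix midBlock Sum.inl * x33 - x22 * F.submatrix midBlock Sum.inl) 0 0 x33,
      (mem_matrixStabilizer_cornerRel_eq hrefl hy hSy hφ hv).2
        ⟨⟨rfl, rfl, rfl⟩, ⟨rfl, rfl, rfl, rfl⟩, rfl, h22⟩⟩, rfl⟩

theorem relIndex_cornerRel_eq [CharZero K] {S : M → M → Prop} {y : M}
    (hrefl : ∀ i, S i i) (hy : ∀ i, S i y) (hSy : ∀ i, S y i → i = y) :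
    relIndex K (cornerRel S (fun j => j = y) : Unit ⊕ M ⊕ Unit → Unit ⊕ M ⊕ Unit → Prop) =
      relIndex K S := by
  classical
  obtain ⟨F, hF⟩ := exists_relIndex_eq K S
  -- For this choice the Schur complement is `F` itself and `v` is the all-ones vector.
  obtain ⟨H, h31, h22, h21, h32, h33, h23⟩ : ∃ H : Matrix (Unit ⊕ M ⊕ Unit) (Unit ⊕ M ⊕ Unit) K,
      H.submatrix lastBlock Sum.inl = 1 ∧ H.submatrix midBlock midBlock = F ∧
      H.submatrix midBlock Sum.inl = 0 ∧ H.submatrix lastBlock midBlock = 0 ∧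
      H.submatrix lastBlock lastBlock = 0 ∧
      H.submatrix midBlock lastBlock = Matrix.of fun _ _ => 1 :=
    ⟨threeBlocks 0 0 0 0 F (Matrix.of fun _ _ => 1) 1 0 0, rfl, rfl, rfl, rfl, rfl, rfl⟩
  refine relIndex_eq H ?_ fun F => ?_
  · rw [finrank_matrixStabilizer_cornerRel_eq hrefl hy hSy h31, h22, h21, Matrix.zero_mul,
      sub_zero, hF]
    rw [h21, h23]
    simp
  · refine le_finrank_matrixStabilizer_of_infinite F (threeBlocks 0 0 0 0 0 0 1 0 0) ?_
    refine Set.Infinite.mono ?_ (infinite_setOf_add_mul_ne_zero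
      (F.submatrix lastBlock Sum.inl () ()) 1 one_ne_zero)
    intro t ht
    rw [Set.mem_ofPred_eq, mul_one] at ht
    rw [Set.mem_ofPred_eq]
    have ht' : (F + t • threeBlocks 0 0 0 0 0 0 1 0 0).submatrix lastBlock Sum.inl () () ≠ 0 := by
      change F.submatrix lastBlock Sum.inl () () + t * (1 : Matrix Unit Unit K) () () ≠ 0
      simpa using ht
    generalize F + t • threeBlocks 0 0 0 0 0 0 1 0 0 = F at ht'
    -- Scaling does not change the stabilizer, so the nonzero corner may be normalized to `1`.
    rw [← matrixStabilizer_smul _ F (inv_ne_zero ht')]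
    have hφ : ((F.submatrix lastBlock Sum.inl () ())⁻¹ • F).submatrix lastBlock Sum.inl = 1 := by
      ext i j
      exact inv_mul_cancel₀ ht'
    generalize (F.submatrix lastBlock Sum.inl () ())⁻¹ • F = F at hφ
    -- A second perturbation, in block `23` only, shifts `v y` by `t` and leaves the corner and the
    -- Schur complement unchanged.
    refine le_finrank_matrixStabilizer_of_infinite F
      (threeBlocks 0 0 0 0 0 (Matrix.of fun _ _ => 1) 0 0 0) ?_
    refine Set.Infinite.mono ?_ (infinite_setOf_add_mul_ne_zero
      (((F.submatrix midBlock midBlock -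
        F.submatrix midBlock Sum.inl * F.submatrix lastBlock midBlock) *
        F.submatrix midBlock Sum.inl + F.submatrix midBlock lastBlock -
        F.submatrix midBlock Sum.inl * F.submatrix lastBlock lastBlock) y ()) 1 one_ne_zero)
    intro t ht
    rw [Set.mem_ofPred_eq, mul_one] at ht
    rw [Set.mem_ofPred_eq]
    set H := F + t • threeBlocks 0 0 0 0 0 (Matrix.of fun _ _ => 1) 0 0 0 with hH
    have b22 : H.submatrix midBlock midBlock = F.submatrix midBlock midBlock := by
      ext i j; simp [hH, threeBlocks, midBlock]
    have b21 : H.submatrix midBlock Sum.inl = F.submatrix midBlock Sum.inl := by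
      ext i j; simp [hH, threeBlocks, midBlock]
    have b32 : H.submatrix lastBlock midBlock = F.submatrix lastBlock midBlock := by
      ext i j; simp [hH, threeBlocks, midBlock, lastBlock]
    have b33 : H.submatrix lastBlock lastBlock = F.submatrix lastBlock lastBlock := by
      ext i j; simp [hH, threeBlocks, lastBlock]
    have b31 : H.submatrix lastBlock Sum.inl = 1 := by
      rw [← hφ]
      ext i j; simp [hH, threeBlocks, lastBlock]
    have b23 : H.submatrix midBlock lastBlock y () = F.submatrix midBlock lastBlock y () + t := by
      simp [hH, threeBlocks, midBlock, lastBlock]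
    rw [finrank_matrixStabilizer_cornerRel_eq hrefl hy hSy b31]
    · exact relIndex_le _ _
    · rw [b22, b21, b32, b33]
      intro h0
      refine ht ?_
      rw [← h0]
      simp only [Matrix.sub_apply, Matrix.add_apply, b23]
      ring

end

/-! ### Seaweed and parabolic algebras given by lists of block sizes. -/

/-- The number of the block of a composition, given by the list of its parts, in which a position
lies. -/
def blockNumber : List ℕ → ℕ → ℕ
  | [], _ => 0
  | p :: l, i => if i < p then 0 else blockNumber l (i - p) + 1

theorem blockNumber_eq_of_mem_block (l : List ℕ) (k i : ℕ) (hk : k < l.length)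
    (h₁ : (l.take k).sum ≤ i) (h₂ : i < (l.take (k + 1)).sum) : blockNumber l i = k := by
  induction l generalizing k i with
  | nil => simp at hk
  | cons p l ih =>
    cases k with
    | zero =>
      have : i < p := by simpa using h₂
      simp [blockNumber, this]
    | succ k =>
      simp only [List.take_succ_cons, List.sum_cons] at h₁ h₂
      have : ¬ i < p := by omega
      rw [blockNumber, if_neg this, ih k (i - p) (by simpa using hk) (by omega) (by omega)]

theorem blockNumber_blocks {n : ℕ} (c : Composition n) (i : Fin n) :
    blockNumber c.blocks i = c.index i :=
  blockNumber_eq_of_mem_block _ _ _ (c.index i).2 (c.sizeUpTo_index_le i)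
    (c.lt_sizeUpTo_index_succ i)

theorem blockNumber_mono (l : List ℕ) {i j : ℕ} (h : i ≤ j) :
    blockNumber l i ≤ blockNumber l j := by
  induction l generalizing i j with
  | nil => exact le_rfl
  | cons p l ih =>
    have := ih (i := i - p) (j := j - p) (by omega)
    simp only [blockNumber]
    split_ifs <;> omega

theorem blockNumber_cons_add (p : ℕ) (l : List ℕ) (i : ℕ) :
    blockNumber (p :: l) (p + i) = blockNumber l i + 1 := by
  simp [blockNumber]

theorem blockNumber_cons_of_lt {p : ℕ} (l : List ℕ) {i : ℕ} (h : i < p) :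
    blockNumber (p :: l) i = 0 := by
  simp [blockNumber, h]

theorem blockNumber_append_of_lt (c l : List ℕ) {i : ℕ} (h : i < c.sum) :
    blockNumber (c ++ l) i = blockNumber c i := by
  induction c generalizing i with
  | nil => simp at h
  | cons p c ih =>
    simp only [List.sum_cons] at h
    simp only [List.cons_append, blockNumber]
    split_ifs
    · rfl
    · rw [ih (by omega)]

theorem blockNumber_append_add (c l : List ℕ) (i : ℕ) :
    blockNumber (c ++ l) (c.sum + i) = c.length + blockNumber l i := by
  induction c with
  | nil => simp
  | cons p c ih =>
    rw [List.cons_append, List.sum_cons, add_assoc, blockNumber_cons_add, ih, List.length_cons]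
    omega

theorem blockNumber_lt_length {c : List ℕ} {i : ℕ} (h : i < c.sum) :
    blockNumber c i < c.length := by
  induction c generalizing i with
  | nil => simp at h
  | cons p c ih =>
    simp only [List.sum_cons] at h
    simp only [List.length_cons, blockNumber]
    split_ifs
    · omega
    · have := ih (i := i - p) (by omega)
      omega

theorem blockNumber_reverse {c : List ℕ} {i : ℕ} (h : i < c.sum) :
    blockNumber c.reverse i + blockNumber c (c.sum - 1 - i) + 1 = c.length := by
  induction c generalizing i with
  | nil => simp at h
  | cons p c ih =>
    simp only [List.sum_cons] at h
    rw [List.reverse_cons, List.sum_cons, List.length_cons]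
    by_cases hi : i < c.sum
    · rw [blockNumber_append_of_lt _ _ (by simpa using hi),
        show p + c.sum - 1 - i = p + (c.sum - 1 - i) by omega, blockNumber_cons_add]
      have := ih hi
      omega
    · obtain ⟨k, rfl⟩ := Nat.exists_eq_add_of_le (not_lt.1 hi)
      have := blockNumber_append_add c.reverse [p] k
      rw [List.sum_reverse, List.length_reverse] at this
      rw [this, blockNumber_cons_of_lt _ (by omega), blockNumber_cons_of_lt _ (by omega)]

/-- The positions of a seaweed algebra given by two lists of block sizes. -/
def pairRel (a b : List ℕ) (n : ℕ) (i j : Fin n) : Prop :=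
  (i ≤ j → blockNumber a i = blockNumber a j) ∧ (j ≤ i → blockNumber b i = blockNumber b j)

/-- The positions of a block upper triangular matrix. -/
def flagRel (c : List ℕ) (n : ℕ) (i j : Fin n) : Prop := blockNumber c i ≤ blockNumber c j

/-- The index of the seaweed algebra given by two lists of block sizes. -/
noncomputable def pairIndex (K : Type*) [Field K] (a b : List ℕ) (n : ℕ) : ℕ :=
  relIndex K (pairRel a b n)

/-- The index of the parabolic algebra given by a list of block sizes. -/
noncomputable def flagIndex (K : Type*) [Field K] (c : List ℕ) (n : ℕ) : ℕ :=
  relIndex K (flagRel c n)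

section
variable (K : Type*) [Field K]

theorem meanderIndex_eq_pairIndex {n : ℕ} (m : Meander n) :
    meanderIndex K m = pairIndex K m.1.blocks m.2.blocks n := by
  rw [meanderIndex_eq_relIndex]
  refine relIndex_congr (Equiv.refl _) fun i j => ?_
  simp only [seaweedPosition, pairRel, blockNumber_blocks, Equiv.refl_apply, Fin.ext_iff]

theorem pairIndex_comm (a b : List ℕ) (n : ℕ) : pairIndex K a b n = pairIndex K b a n := by
  refine (relIndex_swap _).symm.trans (relIndex_congr (Equiv.refl _) fun i j => ?_)
  simp only [pairRel, Equiv.refl_apply]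
  rw [and_comm, @eq_comm _ (blockNumber a j), @eq_comm _ (blockNumber b j)]

theorem relIndex_of_forall [CharZero K] {n : ℕ} {S : Fin n → Fin n → Prop} (h : ∀ i j, S i j) :
    relIndex K S = n :=
  (relIndex_congr (Equiv.refl _) fun i j => by simp [h]).trans (relIndex_true (K := K) n)

theorem pairIndex_single_single [CharZero K] (n : ℕ) : pairIndex K [n] [n] n = n :=
  relIndex_of_forall K fun i j => by
    simp [pairRel, blockNumber_cons_of_lt]

theorem pairIndex_zero [CharZero K] (a b : List ℕ) : pairIndex K a b 0 = 0 :=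
  relIndex_of_forall K fun i => i.elim0

theorem flagIndex_zero [CharZero K] (c : List ℕ) : flagIndex K c 0 = 0 :=
  relIndex_of_forall K fun i => i.elim0

theorem flagIndex_single [CharZero K] (n : ℕ) : flagIndex K [n] n = n :=
  relIndex_of_forall K fun i j => by simp [flagRel, blockNumber_cons_of_lt]

/-- A single top block leaves only the condition below the diagonal; as block numbers increase with
the position, this is block upper triangularity. -/
theorem pairIndex_single (c : List ℕ) (n : ℕ) : pairIndex K [n] c n = flagIndex K c n := by
  refine relIndex_congr (Equiv.refl _) fun i j => ?_
  simp only [pairRel, flagRel, Equiv.refl_apply, blockNumber_cons_of_lt _ i.2,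
    blockNumber_cons_of_lt _ j.2, implies_true, true_and]
  rcases le_or_gt j i with h | h
  · have := blockNumber_mono c (show (j : ℕ) ≤ i from h)
    exact ⟨fun h' => (h' h).le, fun h' _ => le_antisymm h' this⟩
  · exact ⟨fun _ => blockNumber_mono c (show (i : ℕ) ≤ j from h.le),
      fun _ h' => absurd h' (not_le.2 h)⟩

/-- The common first block is a direct summand `𝔤𝔩ₚ`. -/
theorem pairIndex_cons_cons_self [CharZero K] (p : ℕ) (a b : List ℕ) (n : ℕ) :
    pairIndex K (p :: a) (p :: b) (p + n) = p + pairIndex K a b n := by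
  have h := relIndex_sumRel (K := K) (fun _ _ : Fin p => True) (pairRel a b n)
  rw [relIndex_true] at h
  refine (relIndex_congr finSumFinEquiv fun i j => ?_).symm.trans h
  rcases i with i | i <;> rcases j with j | j
  · simp [sumRel, pairRel, blockNumber_cons_of_lt]
  · simp only [sumRel, pairRel, finSumFinEquiv_apply_left, finSumFinEquiv_apply_right,
      Fin.le_def, Fin.val_castAdd, Fin.val_natAdd, blockNumber_cons_add,
      blockNumber_cons_of_lt _ i.2, false_iff, not_and_or]
    left
    have := i.2
    intro h
    have := h (by omega)
    omega
  · simp only [sumRel, pairRel, finSumFinEquiv_apply_left, finSumFinEquiv_apply_right,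
      Fin.le_def, Fin.val_castAdd, Fin.val_natAdd, blockNumber_cons_add,
      blockNumber_cons_of_lt _ j.2, false_iff, not_and_or]
    right
    have := j.2
    intro h
    have := h (by omega)
    omega
  · simp only [sumRel, pairRel, finSumFinEquiv_apply_right, Fin.le_def, Fin.val_natAdd,
      blockNumber_cons_add, add_le_add_iff_left, add_left_inj]

/-- The first node is a leaf: it is linked only to the second node, by the lower block of size two.
Removing it shortens that block to size one. -/
theorem pairIndex_one_cons_two_cons [CharZero K] (a b : List ℕ) (n : ℕ) :
    pairIndex K (1 :: a) (2 :: b) (1 + (n + 1)) = pairIndex K a (1 :: b) (n + 1) := by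
  have hb : ∀ i, blockNumber (2 :: b) (1 + i) = blockNumber (1 :: b) i := fun i => by
    simp only [blockNumber]
    rw [show 1 + i - 2 = i - 1 by omega]
    split_ifs <;> omega
  have hb1 : ∀ i, blockNumber (1 :: b) i = 0 ↔ i = 0 := fun i => by simp [blockNumber]
  have h := relIndex_leafRel (K := K) (S := pairRel a (1 :: b) (n + 1)) (y := 0)
    (by simp [pairRel]) (fun i hi => Fin.ext ((hb1 _).1 ((hi.2 (Fin.zero_le i)).trans rfl)))
  refine (relIndex_congr ((Equiv.sumCongr finOneEquiv.symm (Equiv.refl _)).trans finSumFinEquiv)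
    fun i j => ?_).symm.trans h
  rcases i with i | i <;> rcases j with j | j
  · simp [leafRel, pairRel]
  · simp only [leafRel, pairRel, Equiv.trans_apply, Equiv.sumCongr_apply, Sum.map_inl, Sum.map_inr,
      finSumFinEquiv_apply_left, finSumFinEquiv_apply_right, Equiv.refl_apply,
      Fin.le_def, Fin.val_castAdd, Fin.val_natAdd, blockNumber_cons_add, false_iff, not_and_or]
    left
    intro h
    have := h (by omega)
    rw [blockNumber_cons_of_lt _ (Fin.is_lt _)] at this
    omega
  · have h0 : ((finOneEquiv.symm j : Fin 1) : ℕ) = 0 := by omega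
    simp only [leafRel, pairRel, Equiv.trans_apply, Equiv.sumCongr_apply, Sum.map_inl, Sum.map_inr,
      finSumFinEquiv_apply_left, finSumFinEquiv_apply_right, Equiv.refl_apply,
      Fin.le_def, Fin.val_castAdd, Fin.val_natAdd, hb, h0]
    rw [blockNumber_cons_of_lt (p := 2) b (by omega), hb1, Fin.ext_iff]
    constructor
    · intro h
      exact ⟨fun h' => by omega, fun _ => h⟩
    · intro h
      exact h.2 (by omega)
  · simp only [leafRel, pairRel, Equiv.trans_apply, Equiv.sumCongr_apply, Sum.map_inr,
      finSumFinEquiv_apply_right, Equiv.refl_apply, Fin.le_def, Fin.val_natAdd,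
      blockNumber_cons_add, hb, add_le_add_iff_left, add_left_inj]

/-- Reversing the order of the positions makes the algebra block lower triangular for the reversed
sizes, and transposition restores the upper triangular form. -/
theorem flagIndex_reverse {c : List ℕ} {n : ℕ} (hc : c.sum = n) :
    flagIndex K c.reverse n = flagIndex K c n := by
  refine (relIndex_congr Fin.revPerm fun i j => ?_).trans (relIndex_swap _)
  subst hc
  have hi := blockNumber_reverse i.2
  have hj := blockNumber_reverse j.2
  simp only [flagRel, Fin.revPerm_apply, Fin.val_rev]
  rw [show c.sum - (i + 1) = c.sum - 1 - i by omega, show c.sum - (j + 1) = c.sum - 1 - j by omega]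
  omega

theorem flagIndex_cons_append_self [CharZero K] {p : ℕ} {c : List ℕ} {n : ℕ} (hc : c.sum = n) :
    flagIndex K (p :: (c ++ [p])) (p + (n + p)) = flagIndex K c n + p := by
  have h := relIndex_cornerRel (K := K) (U := Fin p) (flagRel c n)
  rw [relIndex_true] at h
  refine (relIndex_congr ((Equiv.sumCongr (Equiv.refl _) finSumFinEquiv).trans finSumFinEquiv)
    fun i j => ?_).symm.trans h
  subst hc
  have hl : ∀ i : Fin c.sum, blockNumber c i < c.length := fun i => blockNumber_lt_length i.2
  rcases i with i | i | i <;> rcases j with j | j | j <;>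
    simp [cornerRel, flagRel, blockNumber_cons_add, blockNumber_append_of_lt,
      blockNumber_append_add, blockNumber_cons_of_lt, hl, (hl _).le]

theorem flagIndex_one_cons_append_two [CharZero K] {c : List ℕ} {n : ℕ} (hc : c.sum = n) :
    flagIndex K (1 :: (c ++ [2])) (1 + ((n + 1) + 1)) = flagIndex K (c ++ [1]) (n + 1) := by
  have hlt : ∀ i : Fin (n + 1), (i : ℕ) = n ∨ (i : ℕ) < c.sum := fun i => by omega
  have hn : ∀ p k, k < p → blockNumber (c ++ [p]) (n + k) = c.length := fun p k hp => by
    rw [← hc, blockNumber_append_add, blockNumber_cons_of_lt _ hp, add_zero]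
  have hmid : ∀ i : Fin (n + 1), blockNumber (c ++ [2]) i = blockNumber (c ++ [1]) i := fun i => by
    rcases hlt i with h | h
    · rw [h]
      exact (hn 2 0 (by omega)).trans (hn 1 0 (by omega)).symm
    · rw [blockNumber_append_of_lt _ _ h, blockNumber_append_of_lt _ _ h]
  have hle : ∀ i : Fin (n + 1), blockNumber (c ++ [1]) i ≤ c.length := fun i =>
    (blockNumber_mono _ (Nat.lt_succ_iff.1 i.2)).trans (hn 1 0 (by omega)).le
  have hge : ∀ i : Fin (n + 1), c.length ≤ blockNumber (c ++ [1]) i ↔ i = Fin.last n := fun i => by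
    rw [Fin.ext_iff, Fin.val_last]
    rcases hlt i with h | h
    · rw [h]
      exact iff_of_true (hn 1 0 (by omega)).ge rfl
    · rw [blockNumber_append_of_lt _ _ h]
      have := blockNumber_lt_length h
      constructor <;> intro <;> omega
  have hlast : blockNumber (c ++ [1]) n = c.length := hn 1 0 (by omega)
  have h := relIndex_cornerRel_eq (K := K) (S := flagRel (c ++ [1]) (n + 1)) (y := Fin.last n)
    (fun i => le_rfl) (fun i => blockNumber_mono _ (Nat.lt_succ_iff.1 i.2))
    (fun i hi => (hge i).1 (hlast.ge.trans hi))
  -- The middle part consists of `c` and the first position of the last block, which plays the role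
  -- of `y`; the final point is the second position of that block.
  refine (relIndex_congr ((Equiv.sumCongr finOneEquiv.symm
    ((Equiv.sumCongr (Equiv.refl _) finOneEquiv.symm).trans finSumFinEquiv)).trans finSumFinEquiv)
    fun i j => ?_).symm.trans h
  have hone : blockNumber (c ++ [2]) (n + 1) = c.length := hn 2 1 (by omega)
  rcases i with i | i | i <;> rcases j with j | j | j <;>
    simp [cornerRel, flagRel, blockNumber_cons_add, hmid, hone, hle, hge,
      blockNumber_cons_of_lt]

end

/-! ### Sums over compositions with parts 1 and 2. -/

/-- The compositions of `n` with all parts in `{1, 2}`, as lists. -/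
def words : ℕ → List (List ℕ)
  | 0 => [[]]
  | 1 => [[1]]
  | n + 2 => (words (n + 1)).map (List.cons 1) ++ (words n).map (List.cons 2)

theorem mem_words {n : ℕ} {c : List ℕ} :
    c ∈ words n ↔ (∀ p ∈ c, p ∈ ({1, 2} : Set ℕ)) ∧ c.sum = n := by
  induction n using words.induct generalizing c with
  | case1 =>
    rw [words, List.mem_singleton]
    constructor
    · rintro rfl
      simp
    · rintro ⟨h1, h2⟩
      cases c with
      | nil => rfl
      | cons p c =>
        have := h1 p (by simp)
        simp only [List.sum_cons, Set.mem_insert_iff, Set.mem_singleton_iff] at h2 this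
        omega
  | case2 =>
    rw [words, List.mem_singleton]
    constructor
    · rintro rfl
      simp
    · rintro ⟨h1, h2⟩
      cases c with
      | nil => simp at h2
      | cons p c =>
        have h3 := h1 p (by simp)
        simp only [List.sum_cons, Set.mem_insert_iff, Set.mem_singleton_iff] at h2 h3
        cases c with
        | nil => simp at h2; rw [h2]
        | cons q c =>
          have h4 := h1 q (by simp)
          simp only [List.sum_cons, Set.mem_insert_iff, Set.mem_singleton_iff] at h2 h4
          omega
  | case3 n ih1 ih2 =>
    rw [words, List.mem_append, List.mem_map, List.mem_map]
    constructor
    · rintro (⟨a, ha, rfl⟩ | ⟨a, ha, rfl⟩)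
      · obtain ⟨h1, h2⟩ := ih1.1 ha
        exact ⟨by simpa using h1, by rw [List.sum_cons, h2]; omega⟩
      · obtain ⟨h1, h2⟩ := ih2.1 ha
        exact ⟨by simpa using h1, by rw [List.sum_cons, h2]; omega⟩
    · rintro ⟨h1, h2⟩
      cases c with
      | nil => simp at h2
      | cons p c =>
        rw [List.sum_cons] at h2
        rcases h1 p (by simp) with rfl | rfl
        · exact .inl ⟨c, ih1.2 ⟨fun q hq => h1 q (by simp [hq]), by omega⟩, rfl⟩
        · exact .inr ⟨c, ih2.2 ⟨fun q hq => h1 q (by simp [hq]), by omega⟩, rfl⟩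

theorem nodup_words (n : ℕ) : (words n).Nodup := by
  induction n using words.induct with
  | case1 => simp [words]
  | case2 => simp [words]
  | case3 n ih1 ih2 =>
    rw [words, List.nodup_append]
    refine ⟨ih1.map List.cons_injective, ih2.map List.cons_injective, ?_⟩
    intro a ha b hb
    obtain ⟨a, -, rfl⟩ := List.mem_map.1 ha
    obtain ⟨b, -, rfl⟩ := List.mem_map.1 hb
    simp

section
variable {R : Type*} [AddCommMonoid R]

/-- The sum of `f` over the compositions of `n` with all parts in `{1, 2}`. -/
def wordSum (n : ℕ) (f : List ℕ → R) : R := ((words n).map f).sum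

theorem wordSum_zero (f : List ℕ → R) : wordSum 0 f = f [] := by simp [wordSum, words]

theorem wordSum_one (f : List ℕ → R) : wordSum 1 f = f [1] := by simp [wordSum, words]

theorem wordSum_cons (n : ℕ) (f : List ℕ → R) :
    wordSum (n + 2) f = wordSum (n + 1) (fun c => f (1 :: c)) + wordSum n fun c => f (2 :: c) := by
  simp [wordSum, words, Function.comp_def]

theorem wordSum_congr {n : ℕ} {f g : List ℕ → R} (h : ∀ c, c.sum = n → f c = g c) :
    wordSum n f = wordSum n g := by
  rw [wordSum, wordSum, List.map_congr_left fun c hc => h c (mem_words.1 hc).2]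

theorem wordSum_add (n : ℕ) (f g : List ℕ → R) :
    wordSum n (fun c => f c + g c) = wordSum n f + wordSum n g :=
  List.sum_map_add

theorem mul_wordSum {R : Type*} [Semiring R] (n : ℕ) (r : R) (f : List ℕ → R) :
    wordSum n (fun c => r * f c) = r * wordSum n f :=
  List.sum_map_mul_left ..

/-- Splitting by the last part instead of the first, as needed to strip parabolic algebras from both
ends. -/
theorem wordSum_append (n : ℕ) (f : List ℕ → R) :
    wordSum (n + 2) f =
      wordSum (n + 1) (fun c => f (c ++ [1])) + wordSum n fun c => f (c ++ [2]) := by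
  induction n using words.induct generalizing f with
  | case1 => simp [wordSum_cons, wordSum_zero, wordSum_one]
  | case2 =>
    simp only [wordSum_cons, wordSum_one, wordSum_zero, List.cons_append, List.nil_append, zero_add]
    abel
  | case3 n ih1 ih2 =>
    have h1 := ih1 fun c => f (1 :: c)
    have h2 := ih2 fun c => f (2 :: c)
    have h3 := wordSum_cons (n + 1) fun c => f (c ++ [1])
    have h4 := wordSum_cons n fun c => f (c ++ [2])
    rw [wordSum_cons]
    change wordSum (n + 1 + 2) _ + wordSum (n + 2) _ = wordSum (n + 1 + 2) _ + wordSum (n + 2) _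
    rw [h1, h2, h3, h4]
    exact add_add_add_comm _ _ _ _

theorem wordSum_comm (m n : ℕ) (f : List ℕ → List ℕ → R) :
    wordSum m (fun a => wordSum n fun b => f a b) =
      wordSum n fun b => wordSum m fun a => f a b := by
  induction m using words.induct generalizing f with
  | case1 => simp only [wordSum_zero]
  | case2 => simp only [wordSum_one]
  | case3 m ih1 ih2 =>
    simp only [wordSum_cons m, wordSum_add]
    rw [ih1 fun a => f (1 :: a), ih2 fun a => f (2 :: a)]

theorem wordSum_reverse (n : ℕ) (f : List ℕ → R) :
    wordSum n (fun c => f c.reverse) = wordSum n f := by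
  induction n using words.induct generalizing f with
  | case1 => simp [wordSum_zero]
  | case2 => simp [wordSum_one]
  | case3 n ih1 ih2 =>
    rw [wordSum_cons, wordSum_append]
    simp only [List.reverse_cons]
    rw [ih1 fun c => f (c ++ [1]), ih2 fun c => f (c ++ [2])]

open Classical in
theorem sum_composition_one_two {J : Set ℕ} (hJ : J = {1, 2}) (n : ℕ) (f : List ℕ → R) :
    (∑ c : Composition n, if ∀ p ∈ c.blocks, p ∈ J then f c.blocks else 0) = wordSum n f := by
  rw [wordSum, ← List.sum_toFinset f (nodup_words n), ← Finset.sum_filter]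
  refine Finset.sum_nbij (fun c => c.blocks) ?_ ?_ ?_ (fun _ _ => rfl)
  · intro c hc
    rw [List.mem_toFinset, mem_words]
    exact ⟨hJ ▸ (Finset.mem_filter.1 hc).2, c.blocks_sum⟩
  · exact fun a _ b _ h => Composition.ext h
  · intro l hl
    obtain ⟨h1, h2⟩ := mem_words.1 (List.mem_toFinset.1 hl)
    refine ⟨⟨l, fun {p} hp => ?_, h2⟩, by simpa [hJ] using h1, rfl⟩
    rcases h1 p hp with h | h
    · rw [h]; exact one_pos
    · rw [Set.mem_singleton_iff.1 h]; exact two_pos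

theorem blocks_eq_singleton {n : ℕ} (c : Composition n) (h : n ∈ c.blocks) : c.blocks = [n] := by
  obtain ⟨s, t, hst⟩ := List.append_of_mem h
  have hsum := c.blocks_sum
  have hpos : ∀ p ∈ c.blocks, 0 < p := fun p hp => c.blocks_pos hp
  rw [hst] at hsum hpos ⊢
  rw [List.sum_append, List.sum_cons] at hsum
  cases s with
  | cons p s =>
    have := hpos p (by simp)
    rw [List.sum_cons] at hsum
    omega
  | nil =>
    cases t with
    | cons p t =>
      have := hpos p (by simp)
      rw [List.sum_cons] at hsum
      omega
    | nil => rfl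

-- A part equal to `n` must be the only one, so exactly one composition is added; `3 ≤ n` ensures
-- that it was not counted before.
open Classical in
theorem sum_composition_one_two_self {J : Set ℕ} {n : ℕ} (hJ : J = {1, 2, n}) (hn : 3 ≤ n)
    (f : List ℕ → R) :
    (∑ c : Composition n, if ∀ p ∈ c.blocks, p ∈ J then f c.blocks else 0) =
      wordSum n f + f [n] := by
  obtain ⟨I, hI⟩ : ∃ I : Set ℕ, I = {1, 2} := ⟨_, rfl⟩
  have hsplit : ∀ c : Composition n,
      (if ∀ p ∈ c.blocks, p ∈ J then f c.blocks else 0) =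
      (if ∀ p ∈ c.blocks, p ∈ I then f c.blocks else 0) +
        if c = Composition.single n (by omega) then f [n] else 0 := by
    intro c
    by_cases h : n ∈ c.blocks
    · have hc := blocks_eq_singleton c h
      have hc' : c = Composition.single n (by omega) := Composition.ext hc
      rw [if_pos hc', hc, if_pos (by simp [hJ]), if_neg (by simp [hI]; omega), zero_add]
    · have hc' : c ≠ Composition.single n (by omega) := by
        rintro rfl
        exact h (by simp)
      rw [if_neg hc', add_zero]
      refine if_congr (forall₂_congr fun p hp => ?_) rfl rfl
      have : p ≠ n := fun h' => h (h' ▸ hp)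
      simp [hJ, hI, this]
  rw [Finset.sum_congr rfl fun c _ => hsplit c, Finset.sum_add_distrib,
    sum_composition_one_two hI,
    Finset.sum_ite_eq' Finset.univ, if_pos (Finset.mem_univ _)]

end

/-! ### Index polynomials and their recurrences. -/

section
variable (K : Type*) [Field K]
open Polynomial

open Classical in
theorem meanderCount_eq_coeff (J : Set ℕ) (n k : ℕ) :
    (meanderCount K J n k : ℚ) = (∑ a : Composition n, if ∀ p ∈ a.blocks, p ∈ J then
      (∑ b : Composition n, if ∀ p ∈ b.blocks, p ∈ J then
        (X : ℚ[X]) ^ pairIndex K a.blocks b.blocks n else 0) else 0).coeff k := by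
  rw [meanderCount, Nat.card_eq_fintype_card, Fintype.card_subtype, Finset.card_filter,
    Fintype.sum_prod_type, finsetSum_coeff, Nat.cast_sum]
  refine Finset.sum_congr rfl fun a _ => ?_
  split_ifs with ha
  · rw [finsetSum_coeff, Nat.cast_sum]
    refine Finset.sum_congr rfl fun b _ => ?_
    split_ifs with h1 h2 h2
    · simp [coeff_X_pow, ← meanderIndex_eq_pairIndex K (a, b), h1.2.2]
    · exact absurd h1.2.1 h2
    · have : k ≠ meanderIndex K (a, b) := fun h => h1 ⟨ha, h2, h.symm⟩
      simp [coeff_X_pow, ← meanderIndex_eq_pairIndex K (a, b), this]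
    · simp
  · simp [ha]

/-- The index polynomial of the meanders on `n` nodes with parts in `{1, 2}`. -/
noncomputable def pairPoly (n : ℕ) : ℚ[X] :=
  wordSum n fun a => wordSum n fun b => X ^ pairIndex K a b n

/-- The index polynomial of the meanders on `n + 1` nodes with parts in `{1, 2}` and first lower
part equal to `1`. -/
noncomputable def leadPoly (n : ℕ) : ℚ[X] :=
  wordSum (n + 1) fun a => wordSum n fun b => X ^ pairIndex K a (1 :: b) (n + 1)

/-- The index polynomial of the parabolic algebras with block sizes in `{1, 2}`. -/
noncomputable def flagPoly (n : ℕ) : ℚ[X] := wordSum n fun c => X ^ flagIndex K c n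

/-- The index polynomial of the parabolic algebras with block sizes in `{1, 2}`, the last of which
is `1`. -/
noncomputable def lastPoly (n : ℕ) : ℚ[X] :=
  wordSum n fun c => X ^ flagIndex K (c ++ [1]) (n + 1)

theorem meanderCount_one_two (n k : ℕ) :
    (meanderCount K {1, 2} n k : ℚ) = (pairPoly K n).coeff k := by
  generalize hJ : ({1, 2} : Set ℕ) = J
  rw [meanderCount_eq_coeff, pairPoly]
  have h := fun a : List ℕ =>
    sum_composition_one_two hJ.symm n fun b => (X : ℚ[X]) ^ pairIndex K a b n
  simp only [h]
  exact congrArg (fun p : ℚ[X] => p.coeff k) (sum_composition_one_two hJ.symm n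
    fun a => wordSum n fun b => X ^ pairIndex K a b n)

theorem meanderCount_one_two_self [CharZero K] {n : ℕ} (hn : 3 ≤ n) (k : ℕ) :
    (meanderCount K {1, 2, n} n k : ℚ) =
      (pairPoly K n + 2 * flagPoly K n + X ^ n).coeff k := by
  generalize hJ : ({1, 2, n} : Set ℕ) = J
  rw [meanderCount_eq_coeff]
  have h := fun a : List ℕ =>
    sum_composition_one_two_self hJ.symm hn fun b => (X : ℚ[X]) ^ pairIndex K a b n
  simp only [h]
  refine congrArg (fun p : ℚ[X] => p.coeff k) ?_
  refine (sum_composition_one_two_self hJ.symm hn fun a =>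
    (wordSum n fun b => X ^ pairIndex K a b n) + X ^ pairIndex K a [n] n).trans ?_
  have h' : ∀ a, pairIndex K a [n] n = flagIndex K a n := fun a => by
    rw [pairIndex_comm, pairIndex_single]
  simp only [wordSum_add, h', pairIndex_single, pairPoly, flagPoly,
    flagIndex_single]
  ring

theorem meanderCount_self_of_lt {n : ℕ} (hn : n < 3) (k : ℕ) :
    meanderCount K {1, 2, n} n k = meanderCount K {1, 2} n k := by
  interval_cases n
  · have : ∀ m : Meander 0, m.1.blocks = [] ∧ m.2.blocks = [] := fun m => by
      have h : ∀ c : Composition 0, c.blocks = [] := fun c => by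
        refine List.eq_nil_iff_forall_not_mem.2 fun p hp => ?_
        have := List.single_le_sum (fun _ _ => Nat.zero_le _) p hp
        have := c.blocks_pos hp
        have := c.blocks_sum
        omega
      exact ⟨h _, h _⟩
    simp [meanderCount, this]
  · rw [show ({1, 2, 1} : Set ℕ) = {1, 2} by ext; simp; tauto]
  · simp [meanderCount]

theorem pairPoly_zero [CharZero K] : pairPoly K 0 = 1 := by
  simp [pairPoly, wordSum_zero, pairIndex_zero]

theorem pairPoly_one [CharZero K] : pairPoly K 1 = X := by
  simp [pairPoly, wordSum_one, pairIndex_single_single]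

/-- The four choices of the first parts: equal ones split off, and both mixed choices give
`leadPoly` after interchanging top and bottom in one of them. -/
theorem pairPoly_add_two [CharZero K] (n : ℕ) :
    pairPoly K (n + 2) = X * pairPoly K (n + 1) + X ^ 2 * pairPoly K n + 2 * leadPoly K n := by
  have h1 : ∀ a b : List ℕ, pairIndex K (1 :: a) (1 :: b) (n + 2) =
      1 + pairIndex K a b (n + 1) := fun a b => by
    rw [← pairIndex_cons_cons_self, show 1 + (n + 1) = n + 2 by omega]
  have h2 : ∀ a b : List ℕ, pairIndex K (2 :: a) (2 :: b) (n + 2) =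
      2 + pairIndex K a b n := fun a b => by
    rw [← pairIndex_cons_cons_self, show 2 + n = n + 2 by omega]
  have h3 : ∀ a b : List ℕ, pairIndex K (1 :: a) (2 :: b) (n + 2) =
      pairIndex K a (1 :: b) (n + 1) := fun a b => by
    rw [← pairIndex_one_cons_two_cons, show 1 + (n + 1) = n + 2 by omega]
  have h4 : ∀ a b : List ℕ, pairIndex K (2 :: a) (1 :: b) (n + 2) =
      pairIndex K b (1 :: a) (n + 1) := fun a b => by
    rw [pairIndex_comm, h3]
  simp only [pairPoly, leadPoly, wordSum_cons n, wordSum_add, h1, h2, h3, h4, pow_add, pow_one,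
    mul_wordSum]
  rw [wordSum_comm n (n + 1)]
  ring

theorem leadPoly_zero [CharZero K] : leadPoly K 0 = X := by
  simp [leadPoly, wordSum_zero, wordSum_one, pairIndex_single_single]

/-- With lower first part `1`, an upper `1` splits off, while an upper `2` returns to the same kind
of meander with the sides interchanged and one node fewer. -/
theorem leadPoly_succ [CharZero K] (n : ℕ) :
    leadPoly K (n + 1) = X * pairPoly K (n + 1) + leadPoly K n := by
  have h1 : ∀ a b : List ℕ, pairIndex K (1 :: a) (1 :: b) (n + 2) =
      1 + pairIndex K a b (n + 1) := fun a b => by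
    rw [← pairIndex_cons_cons_self, show 1 + (n + 1) = n + 2 by omega]
  have h4 : ∀ a b : List ℕ, pairIndex K (2 :: a) (1 :: b) (n + 2) =
      pairIndex K b (1 :: a) (n + 1) := fun a b => by
    rw [pairIndex_comm, ← pairIndex_one_cons_two_cons, show 1 + (n + 1) = n + 2 by omega]
  simp only [leadPoly, pairPoly, wordSum_cons n, h1, h4, pow_add, pow_one, mul_wordSum]
  rw [wordSum_comm n (n + 1)]

theorem flagIndex_one_append_one [CharZero K] {c : List ℕ} {n : ℕ} (hc : c.sum = n) :
    flagIndex K (1 :: (c ++ [1])) (n + 2) = flagIndex K c n + 1 := by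
  rw [← flagIndex_cons_append_self K hc, show 1 + (n + 1) = n + 2 by omega]

theorem flagIndex_two_append_two [CharZero K] {c : List ℕ} {n : ℕ} (hc : c.sum = n) :
    flagIndex K (2 :: (c ++ [2])) (n + 4) = flagIndex K c n + 2 := by
  rw [← flagIndex_cons_append_self K hc, show 2 + (n + 2) = n + 4 by omega]

theorem flagIndex_one_append_two [CharZero K] {c : List ℕ} {n : ℕ} (hc : c.sum = n) :
    flagIndex K (1 :: (c ++ [2])) (n + 3) = flagIndex K (c ++ [1]) (n + 1) := by
  rw [← flagIndex_one_cons_append_two K hc, show 1 + (n + 1 + 1) = n + 3 by omega]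

/-- This is the case of outer blocks `1` and `2` read backwards, which reverses the inner word; the
sums over all words do not see this reversal. -/
theorem flagIndex_two_append_one [CharZero K] {c : List ℕ} {n : ℕ} (hc : c.sum = n) :
    flagIndex K (2 :: (c ++ [1])) (n + 3) = flagIndex K (c.reverse ++ [1]) (n + 1) := by
  rw [← flagIndex_one_append_two K (c := c.reverse) (by rwa [List.sum_reverse]),
    ← flagIndex_reverse K (by simp [hc]; omega)]
  simp

theorem flagPoly_zero [CharZero K] : flagPoly K 0 = 1 := by
  simp [flagPoly, wordSum_zero, flagIndex_zero]

theorem flagPoly_one [CharZero K] : flagPoly K 1 = X := by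
  simp [flagPoly, wordSum_one, flagIndex_single]

theorem flagPoly_two [CharZero K] : flagPoly K 2 = X + X ^ 2 := by
  have h := flagIndex_one_append_one K (c := []) (n := 0) rfl
  rw [flagIndex_zero] at h
  simp only [List.nil_append, zero_add] at h
  simp [flagPoly, wordSum_cons 0, wordSum_one, wordSum_zero, flagIndex_single, h]

theorem flagPoly_three [CharZero K] : flagPoly K 3 = X ^ 2 + 2 * X := by
  have h1 := flagIndex_one_append_one K (c := [1]) (n := 1) rfl
  have h2 := flagIndex_one_append_two K (c := []) (n := 0) rfl
  have h3 := flagIndex_two_append_one K (c := []) (n := 0) rfl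
  simp only [List.nil_append, List.cons_append, List.reverse_nil, zero_add, flagIndex_single,
    Nat.reduceAdd] at h1 h2 h3
  simp only [flagPoly, wordSum_cons 1, wordSum_cons 0, wordSum_one, wordSum_zero, h1, h2, h3,
    Nat.reduceAdd]
  ring

theorem lastPoly_zero [CharZero K] : lastPoly K 0 = X := by
  simp [lastPoly, wordSum_zero, flagIndex_single]

theorem lastPoly_one [CharZero K] : lastPoly K 1 = X := by
  have h := flagIndex_one_append_one K (c := []) (n := 0) rfl
  rw [flagIndex_zero] at h
  simp only [List.nil_append, zero_add] at h
  simp [lastPoly, wordSum_one, h]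

theorem lastPoly_add_two [CharZero K] (n : ℕ) :
    lastPoly K (n + 2) = X * flagPoly K (n + 1) + lastPoly K n := by
  simp only [lastPoly, flagPoly, wordSum_cons n, ← mul_wordSum, List.cons_append]
  refine congrArg₂ _ (wordSum_congr fun c hc => ?_) ?_
  · rw [flagIndex_one_append_one K hc, pow_succ']
  · rw [← wordSum_reverse]
    refine wordSum_congr fun c hc => ?_
    rw [flagIndex_two_append_one K (by rwa [List.sum_reverse]), List.reverse_reverse]

/-- The four choices of first and last part; the two mixed ones contribute equally. The shift by
four is what outer parts `2` and `2` take up. -/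
theorem flagPoly_add_four [CharZero K] (n : ℕ) :
    flagPoly K (n + 4) =
      X * flagPoly K (n + 2) + 2 * lastPoly K (n + 1) + X ^ 2 * flagPoly K n := by
  have h11 : (wordSum (n + 2) fun c => (X : ℚ[X]) ^ flagIndex K (1 :: (c ++ [1])) (n + 4)) =
      X * flagPoly K (n + 2) := by
    rw [flagPoly, ← mul_wordSum]
    exact wordSum_congr fun c hc => by rw [flagIndex_one_append_one K hc, pow_succ']
  have h12 : (wordSum (n + 1) fun c => (X : ℚ[X]) ^ flagIndex K (1 :: (c ++ [2])) (n + 4)) =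
      lastPoly K (n + 1) :=
    wordSum_congr fun c hc => by rw [flagIndex_one_append_two K hc]
  have h21 : (wordSum (n + 1) fun c => (X : ℚ[X]) ^ flagIndex K (2 :: (c ++ [1])) (n + 4)) =
      lastPoly K (n + 1) := by
    rw [lastPoly, ← wordSum_reverse]
    exact wordSum_congr fun c hc => by
      rw [flagIndex_two_append_one K (by rwa [List.sum_reverse]), List.reverse_reverse]
  have h22 : (wordSum n fun c => (X : ℚ[X]) ^ flagIndex K (2 :: (c ++ [2])) (n + 4)) =
      X ^ 2 * flagPoly K n := by
    rw [flagPoly, ← mul_wordSum]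
    exact wordSum_congr fun c hc => by rw [flagIndex_two_append_two K hc, pow_add, mul_comm]
  rw [flagPoly, wordSum_cons (n + 2), wordSum_append (n + 1),
    wordSum_append n fun c => (X : ℚ[X]) ^ flagIndex K (2 :: c) (n + 4), h11, h12, h21, h22]
  ring

end

/-! ### Generating functions. -/

/-- The power series whose coefficient of `x ^ n` is the polynomial `a n` in `y`. -/
noncomputable def polySeries (a : ℕ → Polynomial ℚ) : MvPowerSeries (Fin 2) ℚ :=
  fun d => (a (d 0)).coeff (d 1)

theorem coeff_polySeries (a : ℕ → Polynomial ℚ) (d : Fin 2 →₀ ℕ) :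
    MvPowerSeries.coeff d (polySeries a) = (a (d 0)).coeff (d 1) := rfl

theorem polySeries_add (a b : ℕ → Polynomial ℚ) :
    polySeries (fun n => a n + b n) = polySeries a + polySeries b := by
  ext d
  simp [coeff_polySeries]

theorem coeff_X_mul_eq (s : Fin 2) (f : MvPowerSeries (Fin 2) ℚ) (d : Fin 2 →₀ ℕ) :
    MvPowerSeries.coeff d (MvPowerSeries.X s * f) =
      if d s = 0 then 0 else MvPowerSeries.coeff (d - Finsupp.single s 1) f := by
  rw [MvPowerSeries.X, MvPowerSeries.coeff_monomial_mul, one_mul]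
  by_cases h : d s = 0
  · rw [if_pos h, if_neg (by simp [h])]
  · rw [if_neg h, if_pos (by simpa using Nat.one_le_iff_ne_zero.2 h)]

/-- Splitting off the constant term in `x` converts recurrences for the polynomials into linear
equations between their series. -/
theorem polySeries_eq_add (a : ℕ → Polynomial ℚ) :
    polySeries a = polySeries (fun n => if n = 0 then a 0 else 0) +
      MvPowerSeries.X 0 * polySeries fun n => a (n + 1) := by
  ext d
  rw [map_add, coeff_X_mul_eq, coeff_polySeries, coeff_polySeries, coeff_polySeries]
  by_cases h : d 0 = 0
  · simp [h]
  · have h1 : (d - Finsupp.single 0 1 : Fin 2 →₀ ℕ) 0 + 1 = d 0 := by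
      simp; omega
    have h2 : (d - Finsupp.single 0 1 : Fin 2 →₀ ℕ) 1 = d 1 := by simp
    rw [if_neg h, if_neg h, h1, h2, Polynomial.coeff_zero, zero_add]

theorem polySeries_X_mul (a : ℕ → Polynomial ℚ) :
    polySeries (fun n => Polynomial.X * a n) = MvPowerSeries.X 1 * polySeries a := by
  ext d
  rw [coeff_X_mul_eq, coeff_polySeries, coeff_polySeries]
  by_cases h : d 1 = 0
  · simp [h]
  · have h1 : (d - Finsupp.single 1 1 : Fin 2 →₀ ℕ) 1 + 1 = d 1 := by
      simp; omega
    have h2 : (d - Finsupp.single 1 1 : Fin 2 →₀ ℕ) 0 = d 0 := by simp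
    rw [if_neg h, ← h1, Polynomial.coeff_X_mul, h2]

theorem polySeries_ite_one :
    polySeries (fun n => if n = 0 then 1 else 0) = 1 := by
  ext d
  rw [coeff_polySeries, MvPowerSeries.coeff_one]
  have : d = 0 ↔ d 0 = 0 ∧ d 1 = 0 := by
    rw [Finsupp.ext_iff, Fin.forall_fin_two]
    rfl
  by_cases h0 : d 0 = 0 <;> by_cases h1 : d 1 = 0 <;>
    simp [this, h0, h1, Polynomial.coeff_one]

theorem polySeries_succ_one (a : ℕ → Polynomial ℚ) (h : a 0 = 1) :
    polySeries a = 1 + MvPowerSeries.X 0 * polySeries fun n => a (n + 1) := by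
  rw [polySeries_eq_add a, h, polySeries_ite_one]

theorem polySeries_succ_X_mul (a : ℕ → Polynomial ℚ) (p : Polynomial ℚ)
    (h : a 0 = Polynomial.X * p) :
    polySeries a = MvPowerSeries.X 1 * polySeries (fun n => if n = 0 then p else 0) +
      MvPowerSeries.X 0 * polySeries fun n => a (n + 1) := by
  rw [polySeries_eq_add a, h, ← polySeries_X_mul]
  simp only [mul_ite, mul_zero]

theorem polySeries_succ_X (a : ℕ → Polynomial ℚ) (h : a 0 = Polynomial.X) :
    polySeries a = MvPowerSeries.X 1 + MvPowerSeries.X 0 * polySeries fun n => a (n + 1) := by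
  rw [polySeries_succ_X_mul a 1 (by rw [h, mul_one]), polySeries_ite_one, mul_one]

theorem polySeries_ite_one_add_X :
    polySeries (fun n => if n = 0 then 1 + Polynomial.X else 0) = 1 + MvPowerSeries.X 1 := by
  have h : ∀ n : ℕ, (if n = 0 then 1 + Polynomial.X else 0 : Polynomial ℚ) =
      (if n = 0 then 1 else 0) + Polynomial.X * (if n = 0 then 1 else 0) := fun n => by
    split_ifs <;> simp
  simp only [h, polySeries_add, polySeries_X_mul, polySeries_ite_one, mul_one]

theorem polySeries_ite_two_add_X :
    polySeries (fun n => if n = 0 then 2 + Polynomial.X else 0) = 2 + MvPowerSeries.X 1 := by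
  have h : ∀ n : ℕ, (if n = 0 then 2 + Polynomial.X else 0 : Polynomial ℚ) =
      (if n = 0 then 1 else 0) + (if n = 0 then 1 + Polynomial.X else 0) := fun n => by
    split_ifs
    · ring
    · simp
  simp only [h, polySeries_add, polySeries_ite_one, polySeries_ite_one_add_X]
  ring

section
variable (K : Type*) [Field K] [CharZero K]

theorem polySeries_pairPoly_mul (x y : MvPowerSeries (Fin 2) ℚ) (hx : x = MvPowerSeries.X 0)
    (hy : y = MvPowerSeries.X 1) :
    polySeries (pairPoly K) * ((1 - x * y - x ^ 2 * y ^ 2) * (1 - x) - 2 * x ^ 2 * y) = 1 - x := by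
  have h1 := polySeries_succ_one _ (pairPoly_zero K)
  have h2 := polySeries_succ_X (fun n => pairPoly K (n + 1)) (pairPoly_one K)
  have h3 := polySeries_succ_X _ (leadPoly_zero K)
  have h4 : polySeries (fun n => pairPoly K (n + 1 + 1)) =
      y * polySeries (fun n => pairPoly K (n + 1)) + y * (y * polySeries (pairPoly K)) +
        (polySeries (leadPoly K) + polySeries (leadPoly K)) := by
    rw [hy, ← polySeries_X_mul, ← polySeries_X_mul, ← polySeries_X_mul, ← polySeries_add,
      ← polySeries_add, ← polySeries_add]
    refine congrArg _ (funext fun n => ?_)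
    rw [pairPoly_add_two]
    ring
  have h5 : polySeries (fun n => leadPoly K (n + 1)) =
      y * polySeries (fun n => pairPoly K (n + 1)) + polySeries (leadPoly K) := by
    rw [hy, ← polySeries_X_mul, ← polySeries_add]
    exact congrArg _ (funext fun n => leadPoly_succ K n)
  rw [← hx] at h1
  rw [← hx, ← hy] at h2 h3
  rw [h4] at h2
  rw [h5] at h3
  generalize polySeries (fun n => pairPoly K (n + 1)) = A₁ at *
  generalize polySeries (pairPoly K) = A at *
  generalize polySeries (leadPoly K) = R at *
  linear_combination (1 - x - x * y - x ^ 2 * y) * h1 + x * (1 - x) * h2 + 2 * x ^ 2 * h3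

theorem polySeries_flagPoly_mul (x y : MvPowerSeries (Fin 2) ℚ) (hx : x = MvPowerSeries.X 0)
    (hy : y = MvPowerSeries.X 1) :
    polySeries (flagPoly K) *
      (1 - x ^ 2 - x ^ 2 * y - x ^ 4 * y - x ^ 4 * y ^ 2 + x ^ 6 * y ^ 2) =
    1 + x * y - x ^ 2 + x ^ 3 * y + x ^ 2 * y ^ 2 - x ^ 4 * y ^ 2 := by
  have h1 := polySeries_succ_one _ (flagPoly_zero K)
  have h2 := polySeries_succ_X (fun n => flagPoly K (n + 1)) (flagPoly_one K)
  have h3 := polySeries_succ_X_mul (fun n => flagPoly K (n + 2)) (1 + Polynomial.X)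
    (by rw [flagPoly_two]; ring)
  have h4 := polySeries_succ_X_mul (fun n => flagPoly K (n + 3)) (2 + Polynomial.X)
    (by rw [flagPoly_three]; ring)
  have h5 := polySeries_succ_X _ (lastPoly_zero K)
  have h6 := polySeries_succ_X (fun n => lastPoly K (n + 1)) (lastPoly_one K)
  have h7 : polySeries (fun n => flagPoly K (n + 4)) =
      y * polySeries (fun n => flagPoly K (n + 2)) +
        (polySeries (fun n => lastPoly K (n + 1)) + polySeries (fun n => lastPoly K (n + 1))) +
        y * (y * polySeries (flagPoly K)) := by
    rw [hy, ← polySeries_X_mul, ← polySeries_X_mul, ← polySeries_X_mul, ← polySeries_add,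
      ← polySeries_add, ← polySeries_add]
    refine congrArg _ (funext fun n => ?_)
    rw [flagPoly_add_four]
    ring
  have h8 : polySeries (fun n => lastPoly K (n + 2)) =
      y * polySeries (fun n => flagPoly K (n + 1)) + polySeries (lastPoly K) := by
    rw [hy, ← polySeries_X_mul, ← polySeries_add]
    exact congrArg _ (funext fun n => lastPoly_add_two K n)
  rw [polySeries_ite_one_add_X] at h3
  rw [polySeries_ite_two_add_X] at h4
  rw [← hx] at h1
  rw [← hx, ← hy] at h2 h3 h4 h5 h6
  simp only [add_assoc, Nat.reduceAdd] at h1 h2 h3 h4 h5 h6 h7 h8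
  rw [h7] at h4
  rw [h8] at h6
  generalize polySeries (fun n => flagPoly K (n + 3)) = P₃ at *
  generalize polySeries (fun n => flagPoly K (n + 2)) = P₂ at *
  generalize polySeries (fun n => flagPoly K (n + 1)) = P₁ at *
  generalize polySeries (flagPoly K) = P at *
  generalize polySeries (fun n => lastPoly K (n + 1)) = Q₁ at *
  generalize polySeries (lastPoly K) = Q at *
  -- The shifted series are eliminated, leaving two linear equations for `P` and `Q`; `Q` is then
  -- eliminated through the factor `1 - x ^ 2`.
  have hP : P = 1 + x * y + x ^ 2 * (y + y ^ 2) + x ^ 3 * (y ^ 2 + 2 * y) +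
      x ^ 2 * y * (P - 1 - x * y) + 2 * x ^ 3 * (Q - y) + x ^ 4 * y ^ 2 * P := by
    linear_combination h1 + x * h2 + x ^ 2 * h3 + x ^ 3 * h4 - 2 * x ^ 3 * h5 -
      x ^ 2 * y * (h1 + x * h2)
  have hQ : Q = y + x * y * P + x ^ 2 * Q := by
    linear_combination h5 + x * h6 - x * y * h1
  linear_combination (1 - x ^ 2) * hP + 2 * x ^ 3 * hQ

theorem polySeries_X_pow_mul (x y : MvPowerSeries (Fin 2) ℚ) (hx : x = MvPowerSeries.X 0)
    (hy : y = MvPowerSeries.X 1) :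
    polySeries (fun n => Polynomial.X ^ n) * (1 - x * y) = 1 := by
  have h := polySeries_succ_one (fun n => Polynomial.X ^ n) (pow_zero _)
  simp only [pow_succ', polySeries_X_mul] at h
  rw [← hx, ← hy] at h
  linear_combination h

omit [CharZero K] in
theorem meanderGenFun_one_two :
    meanderGenFun K (fun _ => {1, 2}) = polySeries (pairPoly K) := by
  ext d
  exact meanderCount_one_two K (d 0) (d 1)

theorem meanderGenFun_one_two_self (x y : MvPowerSeries (Fin 2) ℚ) (hx : x = MvPowerSeries.X 0)
    (hy : y = MvPowerSeries.X 1) :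
    meanderGenFun K (fun n => {1, 2, n}) = polySeries (pairPoly K) +
      2 * (polySeries (flagPoly K) - 1 - x * y - x ^ 2 * (y + y ^ 2)) +
      (polySeries (fun n => Polynomial.X ^ n) - 1 - x * y - x ^ 2 * y ^ 2) := by
  -- The contribution of the meanders that use the part `n`, absent below three nodes.
  let T : ℕ → Polynomial ℚ := fun n => if n < 3 then 0 else 2 * flagPoly K n + Polynomial.X ^ n
  have hT : meanderGenFun K (fun n => {1, 2, n}) = polySeries (pairPoly K) + polySeries T := by
    rw [← polySeries_add]
    ext d
    rw [coeff_polySeries]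
    change (meanderCount K {1, 2, d 0} (d 0) (d 1) : ℚ) = _
    by_cases h : d 0 < 3
    · rw [meanderCount_self_of_lt K h, meanderCount_one_two]
      simp [T, h]
    · rw [meanderCount_one_two_self K (not_lt.1 h)]
      simp only [T, if_neg h, add_assoc]
  have hz : polySeries (fun n => if n = 0 then (0 : Polynomial ℚ) else 0) = 0 := by
    ext d
    simp [coeff_polySeries]
  have t0 := polySeries_eq_add T
  have t1 := polySeries_eq_add fun n => T (n + 1)
  have t2 := polySeries_eq_add fun n => T (n + 2)
  have T0 : T 0 = 0 := rfl
  have T1 : T (0 + 1) = 0 := rfl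
  have T2 : T (0 + 2) = 0 := rfl
  rw [T0, hz] at t0
  rw [T1, hz] at t1
  rw [T2, hz] at t2
  have t3 : polySeries (fun n => T (n + 3)) =
      polySeries (fun n => flagPoly K (n + 3)) + polySeries (fun n => flagPoly K (n + 3)) +
        y * (y * (y * polySeries (fun n => Polynomial.X ^ n))) := by
    rw [hy, ← polySeries_X_mul, ← polySeries_X_mul, ← polySeries_X_mul, ← polySeries_add,
      ← polySeries_add]
    refine congrArg _ (funext fun n => ?_)
    simp only [T, if_neg (show ¬ n + 3 < 3 by omega)]
    ring
  have h1 := polySeries_succ_one _ (flagPoly_zero K)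
  have h2 := polySeries_succ_X (fun n => flagPoly K (n + 1)) (flagPoly_one K)
  have h3 := polySeries_succ_X_mul (fun n => flagPoly K (n + 2)) (1 + Polynomial.X)
    (by rw [flagPoly_two]; ring)
  rw [polySeries_ite_one_add_X] at h3
  have hG := polySeries_X_pow_mul x y hx hy
  rw [← hx] at h1 t0 t1 t2
  rw [← hx, ← hy] at h2 h3
  simp only [add_assoc, Nat.reduceAdd] at t0 t1 t2 t3 h1 h2 h3
  rw [hT]
  linear_combination t0 + x * t1 + x ^ 2 * t2 + x ^ 3 * t3 - 2 * h1 - 2 * x * h2 - 2 * x ^ 2 * h3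
    - (1 + x * y + x ^ 2 * y ^ 2) * hG

end

theorem mainTheorem12 (K : Type*) [Field K] [CharZero K]
    (x y : MvPowerSeries (Fin 2) ℚ) (hx : x = MvPowerSeries.X 0) (hy : y = MvPowerSeries.X 1) :
    meanderGenFun K (fun n => {1, 2, n}) =
        meanderGenFun K (fun _ => {1, 2})
          + (3 * x ^ 3 * y ^ 3 + 2 * x ^ 3 * y ^ 2 - 2 * x ^ 2 * y - 2) * (1 - x * y)⁻¹
          + 2 * (1 + x * y - x ^ 2 + x ^ 3 * y + x ^ 2 * y ^ 2 - x ^ 4 * y ^ 2)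
            * (1 - x ^ 2 - x ^ 2 * y - x ^ 4 * y - x ^ 4 * y ^ 2 + x ^ 6 * y ^ 2)⁻¹ ∧
      meanderGenFun K (fun _ => {1, 2}) =
        (1 - x) * ((1 - x * y - x ^ 2 * y ^ 2) * (1 - x) - 2 * x ^ 2 * y)⁻¹ := by
  have cx : MvPowerSeries.constantCoeff x = 0 := by rw [hx, MvPowerSeries.constantCoeff_X]
  have hG := (MvPowerSeries.eq_inv_iff_mul_eq_one (by simp [cx])).2
    (polySeries_X_pow_mul x y hx hy)
  have hP := (MvPowerSeries.eq_mul_inv_iff_mul_eq (by simp [cx])).2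
    (polySeries_flagPoly_mul K x y hx hy)
  have hA := (MvPowerSeries.eq_mul_inv_iff_mul_eq (by simp [cx])).2
    (polySeries_pairPoly_mul K x y hx hy)
  refine ⟨?_, (meanderGenFun_one_two K).trans hA⟩
  rw [meanderGenFun_one_two_self K x y hx hy, meanderGenFun_one_two, ← hG]
  -- The low-order terms to be subtracted add up to `3 + 3xy + 2x²y + 3x²y²`; multiplied by `1 - xy`
  -- and subtracted from `1`, they give the numerator over `1 - xy`.
  linear_combination 2 * hP + (3 + 3 * x * y + 2 * x ^ 2 * y + 3 * x ^ 2 * y ^ 2) *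
    polySeries_X_pow_mul x y hx hy
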